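/- **Urban intersection with slotted Aloha.** Two roads $\mathrm H=\{(x,0)\}$ and $\mathrm V=\{(0,y)\}$ carry vehicles that form independent homogeneous Poisson point processes of intensities $\lambda_{\mathrm H},\lambda_{\mathrm V}\ge 0$. Each vehicle transmits, independently, with probability $p\in[0,1]$, with power $P>0$. The receiver is at $\mathbf x_{\rm rx}=(x_{\rm rx},0)$, the transmitter at $\mathbf x_{\rm tx}\in\mathbb R^2$, $\mathbf x_{\rm tx}\ne\mathbf x_{\rm rx}$; put $d=|x_{\rm rx}|$. The noise power is $N\ge 0$ and the threshold is $\beta>0$. Let $l_{\rm M}(\mathbf x,\mathbf y)=A\|\mathbf x-\mathbf y\|_1^{-\alpha}$ and $l_{\rm E}(\mathbf x,\mathbf y)=A_{\rm E}\|\mathbf x-\mathbf y\|_2^{-\alpha_{\rm E}}$ with $A,A_{\rm E}>0$ and $\alpha,\alpha_{\rm E}>1$ (possibly, but not necessarily, $A=A_{\rm E}$ and $\alpha=\alpha_{\rm E}$). Let $E(k,\theta)$ be the Erlang law with integer shape $k\ge1$ and scale $\theta>0$. The useful link has path loss $l_{\rm M}$ and fading $S_0\sim E(k_0,\theta_0)$;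 interferers on $\mathrm V$ have path loss $l_{\rm M}$ and fading $E(k_{\mathrm V},\theta_{\mathrm V})$; interferers on $\mathrm H$ have path loss $l_{\rm E}$ and fading $E(1,1)$. All fading variables, transmission decisions and point processes are mutually independent. The reception probability is the probability that $$\mathrm{SINR}=\frac{P S_0\, l_{\rm M}(\mathbf x_{\rm tx},\mathbf x_{\rm rx})}{\sum_{\mathbf x\in\Phi_{\mathrm H}}P S_{\mathbf x}l_{\rm E}(\mathbf x,\mathbf x_{\rm rx})+\sum_{\mathbf x\in\Phi_{\mathrm V}}P S_{\mathbf x}l_{\rm M}(\mathbf x,\mathbf x_{\rm rx})+N}\ \ge\ \beta ,$$ where $\Phi_{\mathrm H},\Phi_{\mathrm V}$ are the processes of transmitting vehicles. Then $$\Pr(\mathrm{SINR}\ge\beta)=e^{-\zeta N/P}\sum_{i=0}^{k_0-1}\sum_{j=0}^{i}\binom ij\frac{\zeta^i}{i!}\,C^{(j)}D^{(i,j)},\qquad \zeta=\frac{\beta\|\mathbf x_{\rm rx}-\mathbf x_{\rm tx}\|_1^{\alpha}}{A\theta_0},$$ where, with $\kappa=2p\lambda_{\mathrm H}A_{\rm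 E}^{1/\alpha_{\rm E}}\frac{\pi}{\alpha_{\rm E}}\csc\frac{\pi}{\alpha_{\rm E}}$ and the Pochhammer symbol $(x)_n=x(x+1)\cdots(x+n-1)$, $$C^{(j)}=\sum_{n=0}^{j}\binom jn\Big(\frac NP\Big)^{j-n}(-1)^n e^{-\kappa\zeta^{1/\alpha_{\rm E}}}\zeta^{-n}\sum_{l=0}^{n}\sum_{m=0}^{l}\frac{(-1)^m\big(-\kappa\zeta^{1/\alpha_{\rm E}}\big)^l\big(\frac{l-m}{\alpha_{\rm E}}+1-n\big)_n}{m!\,(l-m)!},$$ which for $\alpha_{\rm E}=2$ reads $$C^{(j)}=\sum_{n=0}^{j}\binom jn\Big(\frac NP\Big)^{j-n}(-1)^n e^{-\kappa\sqrt\zeta}\zeta^{-n}\sum_{l=0}^{n}\sum_{m=0}^{l}\frac{(-1)^m(-\kappa\sqrt\zeta)^l\big(\frac{2-m+l-2n}{2}\big)_n}{m!\,(l-m)!},$$ and $D^{(i,j)}=(-1)^{i-j}\frac{d^{\,i-j}}{d\zeta^{\,i-j}}\mathcal L_{\mathrm V}(\zeta)$. Here, for $s>0$, $$\mathcal L_{\mathrm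 V}(s)=\exp\Big(-2p\lambda_{\mathrm V}\sum_{q=0}^{k_{\mathrm V}-1}\binom{k_{\mathrm V}}q\frac{(As\theta_{\mathrm V})^{-q}\,\Gamma(\frac1\alpha+q)}{\alpha\,\Gamma(k_{\mathrm V})}\Big((As\theta_{\mathrm V})^{\frac1\alpha+q}\,\Gamma\big(k_{\mathrm V}-q-\tfrac1\alpha\big)-d^{\,1+\alpha q}\,\Gamma(k_{\mathrm V})\,{}_2\tilde F_1\big(k_{\mathrm V},\tfrac1\alpha+q;1+\tfrac1\alpha+q;-\tfrac{d^\alpha}{As\theta_{\mathrm V}}\big)\Big)\Big),$$ and ${}_2\tilde F_1(a,b;c;z)={}_2F_1(a,b;c;z)/\Gamma(c)$ is the regularized Gauss hypergeometric function (real-analytically continued to $z<1$). The function $\mathcal L_{\mathrm V}$ is smooth on $(0,\infty)$. The interference $I_{\mathrm V}=\sum_{\mathbf x\in\Phi_{\mathrm V}}S_{\mathbf x}l_{\rm M}(\mathbf x,\mathbf x_{\rm rx})$ is almost surely finite, and $\mathcal L_{\mathrm V}(s)=\mathbb E[e^{-sI_{\mathrm V}}]$ for every $s>0$. -/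

import Mathlib

open MeasureTheory ProbabilityTheory
open scoped ENNReal NNReal

noncomputable section

/-! ### Propagation and fading -/

/-- Manhattan path loss `A * ‖y - x‖₁ ^ (-α)`; it is infinite when `x = y`. -/
def manhattanLoss (A α : ℝ) (x y : ℝ × ℝ) : ℝ≥0∞ :=
  ENNReal.ofReal A * ENNReal.ofReal (|y.1 - x.1| + |y.2 - x.2|) ^ (-α)

/-- Euclidean path loss `A * ‖y - x‖₂ ^ (-α)`; it is infinite when `x = y`. -/
def euclideanLoss (A α : ℝ) (x y : ℝ × ℝ) : ℝ≥0∞ :=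
  ENNReal.ofReal A * ENNReal.ofReal (√((y.1 - x.1) ^ 2 + (y.2 - x.2) ^ 2)) ^ (-α)

/-- The Erlang law with shape `k` and scale `θ` (rate `1 / θ`);
`erlangLaw 1 1` is the exponential law with mean one. -/
def erlangLaw (k : ℕ) (θ : ℝ) : Measure ℝ := gammaMeasure (k : ℝ) θ⁻¹

/-! ### Poisson point processes and the intersection -/

/-- The random counting measure `∑ₙ δ_{X n}` of an enumerated family of random points. -/
def countingMeasure {Ω ι : Type*} (X : ι → Ω → ℝ) (ω : Ω) : Measure ℝ :=
  Measure.sum fun n => Measure.dirac (X n ω)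

/-- The points `X n` form a homogeneous Poisson point process of intensity `lam` on the line:
numbers of points in pairwise disjoint Borel sets are independent, and the number of points in a
Borel set `B` of finite length is Poisson distributed with mean `lam` times the length of `B`.
(The countable index type is empty for `lam = 0`, and infinite for `0 < lam`.) -/
structure IsPoissonPointProcess {Ω ι : Type*} [MeasurableSpace Ω]
    (X : ι → Ω → ℝ) (lam : ℝ) (μ : Measure Ω) : Prop where
  measurable_point : ∀ n, Measurable (X n)
  hasLaw_count : ∀ B : Set ℝ, MeasurableSet B → volume B < ∞ →
    HasLaw (fun ω => countingMeasure X ω B)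
      ((poissonMeasure (lam * volume.real B).toNNReal).map (Nat.cast : ℕ → ℝ≥0∞)) μ
  indep_count : ∀ (m : ℕ) (B : Fin m → Set ℝ), (∀ r, MeasurableSet (B r)) →
    Pairwise (fun r s => Disjoint (B r) (B s)) →
    iIndepFun (fun r ω => countingMeasure X ω (B r)) μ

/-- The sources of randomness: the fading of the useful link, the point process of either road,
and, for each individual vehicle, its channel access and its fading. -/
inductive RandomSource (ιH ιV : Type*)
  | usefulFading
  | pointsH
  | pointsV
  | accessH (n : ιH)
  | accessV (n : ιV)
  | fadingH (n : ιH)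
  | fadingV (n : ιV)

/-- The σ-algebra generated by each source of randomness. -/
@[reducible] def RandomSource.sigma {Ω ιH ιV : Type*}
    (XH : ιH → Ω → ℝ) (TH : ιH → Ω → Bool) (SH : ιH → Ω → ℝ)
    (XV : ιV → Ω → ℝ) (TV : ιV → Ω → Bool) (SV : ιV → Ω → ℝ) (S0 : Ω → ℝ) :
    RandomSource ιH ιV → MeasurableSpace Ω
  | .usefulFading => MeasurableSpace.comap S0 inferInstance
  | .pointsH => MeasurableSpace.comap (fun ω n => XH n ω) inferInstance
  | .pointsV => MeasurableSpace.comap (fun ω n => XV n ω) inferInstance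
  | .accessH n => MeasurableSpace.comap (TH n) inferInstance
  | .accessV n => MeasurableSpace.comap (TV n) inferInstance
  | .fadingH n => MeasurableSpace.comap (SH n) inferInstance
  | .fadingV n => MeasurableSpace.comap (SV n) inferInstance

/-- Slotted Aloha at the intersection of two roads: vehicles form Poisson point processes of
intensities `lamH` and `lamV` on the roads; vehicle `n` of road `R` transmits iff `TR n = true`,
which has probability `p`; its fading `SR n` has law `νR`; the useful link has fading `S0` of law
`ν0`; and all these sources of randomness are mutually independent. -/
structure IsAlohaIntersection {Ω ιH ιV : Type*} [MeasurableSpace Ω] (μ : Measure Ω)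
    (lamH lamV p : ℝ) (νH νV ν0 : Measure ℝ)
    (XH : ιH → Ω → ℝ) (TH : ιH → Ω → Bool) (SH : ιH → Ω → ℝ)
    (XV : ιV → Ω → ℝ) (TV : ιV → Ω → Bool) (SV : ιV → Ω → ℝ) (S0 : Ω → ℝ) : Prop where
  pointsH : IsPoissonPointProcess XH lamH μ
  pointsV : IsPoissonPointProcess XV lamV μ
  measurable_accessH : ∀ n, Measurable (TH n)
  measurable_accessV : ∀ n, Measurable (TV n)
  accessH : ∀ n, μ {ω | TH n ω = true} = ENNReal.ofReal p
  accessV : ∀ n, μ {ω | TV n ω = true} = ENNReal.ofReal p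
  measurable_fadingH : ∀ n, Measurable (SH n)
  measurable_fadingV : ∀ n, Measurable (SV n)
  fadingH : ∀ n, HasLaw (SH n) νH μ
  fadingV : ∀ n, HasLaw (SV n) νV μ
  measurable_usefulFading : Measurable S0
  usefulFading : HasLaw S0 ν0 μ
  indep : iIndep (RandomSource.sigma XH TH SH XV TV SV S0) μ

/-- Total power received at `rx` from the transmitting vehicles of one road, `pos n ω` being the
position in the plane of vehicle `n`, and `P` the transmit power. -/
def receivedInterference {Ω ι : Type*} (P : ℝ) (loss : ℝ × ℝ → ℝ × ℝ → ℝ≥0∞)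
    (pos : ι → Ω → ℝ × ℝ) (T : ι → Ω → Bool) (S : ι → Ω → ℝ) (rx : ℝ × ℝ) (ω : Ω) : ℝ≥0∞ :=
  ∑' n, if T n ω = true then ENNReal.ofReal (P * S n ω) * loss (pos n ω) rx else 0

/-- The signal-to-interference-plus-noise ratio at the receiver `rx`, for a transmitter at `tx`,
with path losses `loss0` (useful link), `lossH` (interferers on the horizontal road) and `lossV`
(interferers on the vertical road). -/
def sinr {Ω ιH ιV : Type*} (P N : ℝ) (loss0 lossH lossV : ℝ × ℝ → ℝ × ℝ → ℝ≥0∞)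
    (XH : ιH → Ω → ℝ) (TH : ιH → Ω → Bool) (SH : ιH → Ω → ℝ)
    (XV : ιV → Ω → ℝ) (TV : ιV → Ω → Bool) (SV : ιV → Ω → ℝ) (S0 : Ω → ℝ)
    (tx rx : ℝ × ℝ) (ω : Ω) : ℝ≥0∞ :=
  (ENNReal.ofReal (P * S0 ω) * loss0 tx rx) /
    (receivedInterference P lossH (fun n ω => (XH n ω, 0)) TH SH rx ω +
      receivedInterference P lossV (fun n ω => (0, XV n ω)) TV SV rx ω + ENNReal.ofReal N)

/-! ### Special functions and the closed-form expressions -/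

/-- `F` is, on `(-∞, 1)`, the real-analytic continuation of the Gauss hypergeometric series. -/
def IsGaussHypergeometric (a b c : ℝ) (F : ℝ → ℝ) : Prop :=
  AnalyticOnNhd ℝ F (Set.Iio 1) ∧ ∀ z, |z| < 1 → F z = ordinaryHypergeometric a b c z

open Classical in
/-- The Gauss hypergeometric function `₂F₁(a, b; c; z)` for real `z < 1`, beyond the disc of
convergence by its (unique) analytic continuation. -/
def gaussHypergeometric (a b c z : ℝ) : ℝ :=
  if h : ∃ F, IsGaussHypergeometric a b c F then h.choose z else 0

/-- The regularized Gauss hypergeometric function `₂F₁(a, b; c; z) / Γ(c)`. -/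
def regGaussHypergeometric (a b c z : ℝ) : ℝ :=
  gaussHypergeometric a b c z / Real.Gamma c

/-- The Pochhammer symbol `(x)ₙ = x (x + 1) ⋯ (x + n - 1)`. -/
def pochhammerSymbol (x : ℝ) (n : ℕ) : ℝ := (ascPochhammer ℝ n).eval x

/-- `κ = 2 p λ_H A ^ (1 / α) (π / α) csc (π / α)`. -/
def kappaH (p lamH A α : ℝ) : ℝ :=
  2 * p * lamH * A ^ (1 / α) * (Real.pi / α) * (1 / Real.sin (Real.pi / α))

/-- The coefficient `C^(j)`, for a path loss exponent `α` on the receiver's own road and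
`Nt = N / P`. -/
def coeffC (κ α Nt ζ : ℝ) (j : ℕ) : ℝ :=
  ∑ n ∈ Finset.range (j + 1), (j.choose n : ℝ) * Nt ^ (j - n) * (-1) ^ n *
    Real.exp (-κ * ζ ^ (1 / α)) * (ζ ^ n)⁻¹ *
    ∑ l ∈ Finset.range (n + 1), ∑ m ∈ Finset.range (l + 1),
      (-1) ^ m * (-κ * ζ ^ (1 / α)) ^ l * pochhammerSymbol (((l : ℝ) - m) / α + 1 - n) n /
        ((m.factorial : ℝ) * ((l - m).factorial : ℝ))

/-- The closed-form Laplace transform, at `s`, of the interference from the crossing road. -/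
def crossRoadLaplace (p lamV : ℝ) (k : ℕ) (θ A α d s : ℝ) : ℝ :=
  Real.exp (-2 * p * lamV * ∑ q ∈ Finset.range k,
    (k.choose q : ℝ) * (1 / (α * Real.Gamma k)) * (A * s * θ) ^ (-(q : ℝ)) *
      Real.Gamma (1 / α + q) *
      ((A * s * θ) ^ (1 / α + q) * Real.Gamma (-(1 / α) + k - q) -
        d ^ (1 + α * q) * Real.Gamma k *
          regGaussHypergeometric k (1 / α + q) (1 + 1 / α + q) (-(d ^ α / (A * s * θ)))))

/-- The coefficient `D^(i,j)`: `(-1) ^ (i - j)` times the `(i - j)`-th derivative at `ζ` of the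
crossing-road Laplace transform. -/
def coeffD (p lamV : ℝ) (k : ℕ) (θ A α d ζ : ℝ) (i j : ℕ) : ℝ :=
  (-1) ^ (i - j) * iteratedDeriv (i - j) (fun s => crossRoadLaplace p lamV k θ A α d s) ζ

end

/-!
Conditionally on the interference, the reception probability is the tail of the Erlang law of the
useful fading, that is `e⁻ᵘ ∑ᵢ uⁱ / i!` with `u = ζ (I_H + I_V + N / P)`. Since the two roads are
independent, the binomial theorem reduces its mean to the moments `E[Iⁿ e^(-ζ I)]` of the
interference of either road (`measureReal_mul_le_erlang`, `integral_erlang_tail`). Up to sign these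
are the derivatives at `ζ` of the Laplace transforms of `I_H` and `I_V` (`iteratedDeriv_laplace`);
for the vertical road they are `D^(i,j)` by definition, and for the horizontal road, whose Laplace
transform is `exp (-κ s ^ (1 / α))`, Hoppe's formula turns them into `C^(j)`
(`iteratedDeriv_exp_neg_mul_rpow`).

The Laplace transform of the interference from one road is computed in `[0, ∞]`-valued integrals,
with `negExp ∞ = 0`, so that no finiteness has to be known beforehand. The Laplace functional
`E[exp (-∑ₙ h(Xₙ))] = exp (-λ ∫ (1 - e⁻ʰ))` of a Poisson process follows from the defining
properties for simple functions `h` and extends by monotone approximation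
(`IsPoissonPointProcess.laplace_functional`). Integrating first over the marks (access and fading)
at fixed positions produces an infinite product, which is `exp (-∑ₙ h(Xₙ))` for
`h = -log E[e^(-Z g)]` (`IsPoissonPointProcess.laplace_shotNoise`). For Erlang fading this leaves
the integral over `(d, ∞)` of `1 - (1 + c r⁻ᵅ)⁻ᵏ`. By the binomial theorem and the substitution
`y = rᵅ` it is a sum of Beta integrals of the second kind over `(0, ∞)` minus Euler integrals of
the Gauss hypergeometric function over `(0, dᵅ)` (`integral_one_sub_inv_pow`). The Euler integral
is analytic on `(-∞, 1)` and has the Gauss series as its expansion at `0`, so it is the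
continuation that defines `gaussHypergeometric` (`gaussHypergeometric_eq_eulerIntegral`).

Both Laplace transforms tend to `1` at `0`, which makes the interferences almost surely finite
(`ae_ne_top_of_laplace`); smoothness of `crossRoadLaplace` on `(0, ∞)` is smoothness of a
moment generating function in the interior of its domain (`contDiffOn_laplace`).
-/

/-! ### The decreasing exponential on `[0, ∞]` -/

/-- The decreasing exponential `x ↦ e⁻ˣ` on `[0, ∞]`, with value `0` at `∞`. -/
noncomputable def negExp (x : ℝ≥0∞) : ℝ≥0∞ := EReal.exp (-(x : EReal))

@[simp] lemma negExp_zero : negExp 0 = 1 := by simp [negExp]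

/-- The value at `∞` is the limit, not a junk value: infinite interference has Laplace transform
`0`. -/
@[simp] lemma negExp_top : negExp ⊤ = 0 := by simp [negExp]

lemma negExp_of_ne_top {x : ℝ≥0∞} (hx : x ≠ ⊤) :
    negExp x = ENNReal.ofReal (Real.exp (-x.toReal)) := by
  lift x to ℝ≥0 using hx
  rw [negExp, ENNReal.coe_toReal, ← EReal.exp_coe]
  rfl

lemma negExp_ofReal {r : ℝ} (hr : 0 ≤ r) :
    negExp (ENNReal.ofReal r) = ENNReal.ofReal (Real.exp (-r)) := by
  rw [negExp_of_ne_top ENNReal.ofReal_ne_top, ENNReal.toReal_ofReal hr]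

lemma continuous_negExp : Continuous negExp :=
  ENNReal.continuous_exp.comp (continuous_neg.comp continuous_coe_ennreal_ereal)

@[fun_prop] lemma measurable_negExp : Measurable negExp := continuous_negExp.measurable

lemma antitone_negExp : Antitone negExp := fun x y h => by
  simpa [negExp] using h

lemma negExp_le_one (x : ℝ≥0∞) : negExp x ≤ 1 := by
  simpa using antitone_negExp (zero_le (a := x))

lemma negExp_ne_top (x : ℝ≥0∞) : negExp x ≠ ⊤ :=
  ((negExp_le_one x).trans_lt ENNReal.one_lt_top).ne

lemma negExp_add (x y : ℝ≥0∞) : negExp (x + y) = negExp x * negExp y := by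
  rw [negExp, negExp, negExp, ← EReal.exp_add, EReal.coe_ennreal_add, EReal.neg_add, sub_eq_add_neg]
  · left; simp
  · right; simp

lemma negExp_sum {ι : Type*} (s : Finset ι) (f : ι → ℝ≥0∞) :
    negExp (∑ i ∈ s, f i) = ∏ i ∈ s, negExp (f i) := by
  classical
  induction s using Finset.induction_on with
  | empty => simp
  | insert a s ha ih => rw [Finset.sum_insert ha, Finset.prod_insert ha, negExp_add, ih]

lemma negExp_mul_natCast (x : ℝ≥0∞) (n : ℕ) : negExp (x * n) = negExp x ^ n := by
  have := negExp_sum (Finset.range n) (fun _ => x)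
  simpa [mul_comm] using this

/-- The inverse of `negExp` on `[0, 1]`. -/
noncomputable def negLog (y : ℝ≥0∞) : ℝ≥0∞ := (-ENNReal.log y).toENNReal

@[fun_prop] lemma measurable_negLog : Measurable negLog :=
  (ENNReal.measurable_log.comp measurable_id).neg.ereal_toENNReal

lemma negExp_negLog {y : ℝ≥0∞} (hy : y ≤ 1) : negExp (negLog y) = y := by
  have : ENNReal.log y ≤ 0 := by simpa using ENNReal.log_monotone hy
  rw [negExp, negLog, EReal.coe_toENNReal (by simpa using this), neg_neg, ENNReal.exp_log]

/-- The Laplace transform of the Poisson law. -/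
lemma lintegral_negExp_mul_poisson (r : ℝ≥0) (x : ℝ≥0∞) :
    ∫⁻ n, negExp (x * n) ∂((poissonMeasure r).map (Nat.cast : ℕ → ℝ≥0∞)) =
      negExp (r * (1 - negExp x)) := by
  rw [lintegral_map (by fun_prop) (by fun_prop), lintegral_countable']
  simp_rw [negExp_mul_natCast, poissonMeasure_singleton]
  set t : ℝ≥0 := (negExp x).toNNReal with ht
  have hx : negExp x = t := (ENNReal.coe_toNNReal (negExp_ne_top x)).symm
  have ht1 : t ≤ 1 := by
    have := negExp_le_one x
    rw [hx] at this; exact_mod_cast this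
  rw [hx]
  have h1 : (r : ℝ≥0∞) * (1 - t) = ENNReal.ofReal ((r : ℝ) * (1 - (t : ℝ))) := by
    rw [ENNReal.ofReal_mul (by positivity), ENNReal.ofReal_sub _ (by positivity)]
    simp
  rw [h1, negExp_ofReal (mul_nonneg r.coe_nonneg (sub_nonneg.2 (NNReal.coe_le_one.2 ht1)))]
  have h2 : ∀ n : ℕ, (t : ℝ≥0∞) ^ n * ENNReal.ofReal (Real.exp (-r) * r ^ n / n.factorial) =
      ENNReal.ofReal (Real.exp (-r) * ((r * t) ^ n / n.factorial)) := fun n => by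
    rw [← ENNReal.ofReal_coe_nnreal, ← ENNReal.ofReal_pow (by positivity),
      ← ENNReal.ofReal_mul (by positivity)]
    congr 1; rw [mul_pow]; ring
  simp_rw [h2]
  have h3 := (NormedSpace.expSeries_div_hasSum_exp (𝔸 := ℝ) (r * t)).mul_left (Real.exp (-r))
  rw [← ENNReal.ofReal_tsum_of_nonneg (fun n => by positivity) h3.summable, h3.tsum_eq,
    ← Real.exp_eq_exp_ℝ, ← Real.exp_add]
  congr 2; ring

lemma tendsto_lintegral_negExp {α ι : Type*} [MeasurableSpace α] {ν : Measure α}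
    [IsFiniteMeasure ν] {l : Filter ι} [l.IsCountablyGenerated] {f : ι → α → ℝ≥0∞}
    {g : α → ℝ≥0∞} (hf : ∀ i, Measurable (f i))
    (h : ∀ a, Filter.Tendsto (fun i => f i a) l (nhds (g a))) :
    Filter.Tendsto (fun i => ∫⁻ a, negExp (f i a) ∂ν) l (nhds (∫⁻ a, negExp (g a) ∂ν)) :=
  tendsto_lintegral_filter_of_dominated_convergence (fun _ => 1)
    (.of_forall fun i => measurable_negExp.comp (hf i))
    (.of_forall fun i => .of_forall fun a => negExp_le_one _) (by simp)
    (.of_forall fun a => (continuous_negExp.tendsto _).comp (h a))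

/-! ### The Laplace functional of a Poisson process -/

section Poisson

variable {Ω ι : Type*} [MeasurableSpace Ω] {μ : Measure Ω} {X : ι → Ω → ℝ} {lam : ℝ}

lemma measurable_lintegral_countingMeasure [Countable ι] (hX : ∀ n, Measurable (X n))
    {h : ℝ → ℝ≥0∞} (hh : Measurable h) :
    Measurable fun ω => ∫⁻ y, h y ∂(countingMeasure X ω) := by
  simp_rw [countingMeasure, lintegral_sum_measure, lintegral_dirac' _ hh]
  exact Measurable.tsum fun n => hh.comp (hX n)

lemma measurable_countingMeasure [Countable ι] (hX : ∀ n, Measurable (X n)) {B : Set ℝ}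
    (hB : MeasurableSet B) : Measurable fun ω => countingMeasure X ω B := by
  simpa [lintegral_indicator_one hB] using
    measurable_lintegral_countingMeasure hX (measurable_one.indicator hB)

/-- The Laplace functional of a Poisson process at a simple function `f` whose nonzero level sets
have finite length. -/
lemma IsPoissonPointProcess.laplace_simpleFunc [Countable ι] [IsProbabilityMeasure μ]
    (hX : IsPoissonPointProcess X lam μ) (hlam : 0 ≤ lam) (f : SimpleFunc ℝ ℝ≥0∞)
    (hf : ∀ c ≠ 0, volume (f ⁻¹' {c}) < ⊤) :
    ∫⁻ ω, negExp (∫⁻ y, f y ∂(countingMeasure X ω)) ∂μ =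
      negExp (ENNReal.ofReal lam * ∫⁻ y, (1 - negExp (f y))) := by
  classical
  have hind : iIndepFun (fun (c : f.range) ω => countingMeasure X ω (f ⁻¹' {c.1})) μ := by
    have h := hX.indep_count f.range.card
      (fun r => f ⁻¹' {(f.range.equivFin.symm r).1}) (fun r => f.measurableSet_fiber _) (by
        intro r s hrs
        refine Disjoint.preimage _ ?_
        rw [Set.disjoint_singleton]
        intro h
        exact hrs (f.range.equivFin.symm.injective (Subtype.ext h)))
    have := h.precomp f.range.equivFin.injective
    simpa using this
  have hterm : ∀ c : f.range, ∫⁻ ω, negExp (c.1 * countingMeasure X ω (f ⁻¹' {c.1})) ∂μ =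
      negExp (ENNReal.ofReal lam * ((1 - negExp c.1) * volume (f ⁻¹' {c.1}))) := by
    intro c
    -- the zero level set may have infinite length, but it contributes nothing to either side
    by_cases hc : c.1 = 0
    · simp [hc]
    have hfin := hf c.1 hc
    have hlaw := hX.hasLaw_count _ (f.measurableSet_fiber c.1) hfin
    rw [hlaw.lintegral_comp (f := fun n => negExp (c.1 * n)) (by fun_prop),
      lintegral_negExp_mul_poisson]
    congr 1
    change ENNReal.ofReal (lam * volume.real (f ⁻¹' {c.1})) * _ = _
    rw [ENNReal.ofReal_mul hlam, Measure.real, ENNReal.ofReal_toReal hfin.ne]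
    ring
  have hmeas : ∀ c : f.range, Measurable fun ω => countingMeasure X ω (f ⁻¹' {c.1}) := fun c =>
    measurable_countingMeasure hX.measurable_point (f.measurableSet_fiber _)
  calc ∫⁻ ω, negExp (∫⁻ y, f y ∂(countingMeasure X ω)) ∂μ
      = ∫⁻ ω, ∏ c : f.range, negExp (c.1 * countingMeasure X ω (f ⁻¹' {c.1})) ∂μ := by
        refine lintegral_congr fun ω => ?_
        rw [← negExp_sum, SimpleFunc.lintegral_eq_lintegral, SimpleFunc.lintegral,
          ← Finset.sum_coe_sort]
    _ = ∏ c : f.range, ∫⁻ ω, negExp (c.1 * countingMeasure X ω (f ⁻¹' {c.1})) ∂μ :=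
        lintegral_prod_eq_prod_lintegral_of_indepFun _ _
          (hind.comp (fun c n => negExp (c.1 * n)) fun c => by fun_prop)
          fun c => measurable_negExp.comp ((hmeas c).const_mul _)
    _ = negExp (ENNReal.ofReal lam * ∫⁻ y, (1 - negExp (f y))) := by
        rw [Finset.prod_congr rfl fun c _ => hterm c, ← negExp_sum, ← Finset.mul_sum,
          Finset.sum_coe_sort f.range (fun c => (1 - negExp c) * volume (f ⁻¹' {c})),
          ← SimpleFunc.map_lintegral (fun c => 1 - negExp c), ← SimpleFunc.lintegral_eq_lintegral]
        rfl

/-- The Laplace functional of a homogeneous Poisson process. -/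
lemma IsPoissonPointProcess.laplace_functional [Countable ι] [IsProbabilityMeasure μ]
    (hX : IsPoissonPointProcess X lam μ) (hlam : 0 ≤ lam) {h : ℝ → ℝ≥0∞} (hh : Measurable h) :
    ∫⁻ ω, negExp (∫⁻ y, h y ∂(countingMeasure X ω)) ∂μ =
      negExp (ENNReal.ofReal lam * ∫⁻ y, (1 - negExp (h y))) := by
  -- truncation to `[-n, n]` makes all nonzero level sets of finite length
  let f : ℕ → SimpleFunc ℝ ℝ≥0∞ := fun n => (SimpleFunc.eapprox h n).restrict (Set.Icc (-n : ℝ) n)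
  have hfapply : ∀ n y, f n y = (Set.Icc (-n : ℝ) n).indicator (SimpleFunc.eapprox h n) y :=
    fun n y => SimpleFunc.restrict_apply _ measurableSet_Icc y
  have hmono : ∀ y, Monotone fun n => f n y := fun y m n hmn => by
    have hmn' : (m : ℝ) ≤ n := by exact_mod_cast hmn
    simp only [hfapply]
    exact (Set.indicator_le_indicator_of_subset
      (Set.Icc_subset_Icc (neg_le_neg hmn') hmn') (fun _ => zero_le) y).trans
      (Set.indicator_le_indicator (SimpleFunc.monotone_eapprox h hmn y))
  have hlim : ∀ y, Filter.Tendsto (fun n => f n y) Filter.atTop (nhds (h y)) := fun y => by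
    refine (SimpleFunc.tendsto_eapprox hh y).congr' ?_
    filter_upwards [Filter.eventually_ge_atTop ⌈|y|⌉₊] with n hn
    rw [hfapply, Set.indicator_of_mem]
    exact abs_le.1 (Nat.ceil_le.1 hn)
  have hsimple : ∀ n, ∫⁻ ω, negExp (∫⁻ y, f n y ∂(countingMeasure X ω)) ∂μ =
      negExp (ENNReal.ofReal lam * ∫⁻ y, (1 - negExp (f n y))) := fun n => by
    refine hX.laplace_simpleFunc hlam (f n) fun c hc => ?_
    refine (measure_mono (fun y hy => ?_)).trans_lt (measure_Icc_lt_top (a := (-n : ℝ)) (b := n))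
    by_contra hy'
    rw [Set.mem_preimage, hfapply, Set.indicator_of_notMem hy'] at hy
    exact hc hy.symm
  have hleft := tendsto_lintegral_negExp (ν := μ) (l := Filter.atTop)
    (f := fun n ω => ∫⁻ y, f n y ∂(countingMeasure X ω))
    (g := fun ω => ∫⁻ y, h y ∂(countingMeasure X ω))
    (fun n => measurable_lintegral_countingMeasure hX.measurable_point (f n).measurable)
    (fun ω => lintegral_tendsto_of_tendsto_of_monotone (fun n => (f n).measurable.aemeasurable)
      (.of_forall hmono) (.of_forall hlim))
  have hright : Filter.Tendsto (fun n => ∫⁻ y, (1 - negExp (f n y))) Filter.atTop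
      (nhds (∫⁻ y, (1 - negExp (h y)))) :=
    lintegral_tendsto_of_tendsto_of_monotone (fun n => by fun_prop)
      (.of_forall fun y m n hmn => tsub_le_tsub_left (antitone_negExp (hmono y hmn)) 1)
      (.of_forall fun y => ENNReal.Tendsto.sub tendsto_const_nhds
        ((continuous_negExp.tendsto _).comp (hlim y)) (Or.inl ENNReal.one_ne_top))
  refine tendsto_nhds_unique hleft ?_
  simp_rw [hsimple]
  exact (continuous_negExp.tendsto _).comp
    (ENNReal.Tendsto.const_mul hright (Or.inr ENNReal.ofReal_ne_top))

end Poisson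

/-! ### Grouping of independent σ-algebras -/

/-- σ-algebras generated by disjoint groups of independent σ-algebras are independent. -/
lemma iIndep_iSup_of_pairwise_disjoint {Ω I J : Type*} {mΩ : MeasurableSpace Ω} {μ : Measure Ω}
    {m : I → MeasurableSpace Ω} (hm : ∀ i, m i ≤ mΩ) (hind : iIndep m μ) {A : J → Set I}
    (hA : Pairwise fun j k => Disjoint (A j) (A k)) :
    iIndep (fun j => ⨆ i ∈ A j, m i) μ := by
  classical
  have := hind.isProbabilityMeasure
  rw [iIndep_iff]
  intro s f hf
  induction s using Finset.induction_on with
  | empty => simp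
  | insert a s ha ih =>
    rw [Finset.prod_insert ha, Finset.set_biInter_insert,
      ← ih fun i hi => hf i (Finset.mem_insert_of_mem hi)]
    have hdisj : Disjoint (A a) (⋃ j ∈ s, A j) := by
      simp only [Set.disjoint_iUnion_right]
      exact fun j hj => hA fun h => ha (h ▸ hj)
    refine (Indep_iff _ _ μ).1 (indep_iSup_of_disjoint hm hind hdisj) _ _
      (hf a (Finset.mem_insert_self a s)) ?_
    refine Finset.measurableSet_biInter s fun j hj => ?_
    have hle : ⨆ i ∈ A j, m i ≤ ⨆ i ∈ ⋃ j ∈ s, A j, m i := iSup₂_le fun i hi =>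
      le_iSup₂_of_le (f := fun i _ => m i) i (Set.mem_biUnion hj hi) le_rfl
    exact hle _ (hf j (Finset.mem_insert_of_mem hj))

/-! ### Shot noise with independent marks -/

/-- The law of the product of a Bernoulli variable of mean `p` and the nonnegative part of an
independent variable of law `ν`. -/
noncomputable def thinnedLaw (p : ℝ) (ν : Measure ℝ) : Measure ℝ≥0∞ :=
  ENNReal.ofReal (1 - p) • Measure.dirac 0 + ENNReal.ofReal p • ν.map ENNReal.ofReal

lemma isProbabilityMeasure_thinnedLaw {p : ℝ} (hp0 : 0 ≤ p) (hp1 : p ≤ 1) (ν : Measure ℝ)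
    [IsProbabilityMeasure ν] : IsProbabilityMeasure (thinnedLaw p ν) := by
  have := Measure.isProbabilityMeasure_map (μ := ν) ENNReal.measurable_ofReal.aemeasurable
  constructor
  simp [thinnedLaw, ← ENNReal.ofReal_add (sub_nonneg.2 hp1) hp0]

lemma hasLaw_thinned {Ω : Type*} [MeasurableSpace Ω] {μ : Measure Ω} [IsProbabilityMeasure μ]
    {p : ℝ} (hp0 : 0 ≤ p) {ν : Measure ℝ} {T : Ω → Bool} {S : Ω → ℝ}
    (hTm : Measurable T) (hSm : Measurable S) (hT : μ {ω | T ω = true} = ENNReal.ofReal p)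
    (hS : HasLaw S ν μ) (hind : IndepFun T S μ) :
    HasLaw (fun ω => if T ω = true then ENNReal.ofReal (S ω) else 0) (thinnedLaw p ν) μ := by
  have hTs : MeasurableSet {ω | T ω = true} := hTm (measurableSet_singleton true)
  refine ⟨(Measurable.ite hTs hSm.ennreal_ofReal measurable_const).aemeasurable, ?_⟩
  have hTc : μ {ω | T ω = true}ᶜ = ENNReal.ofReal (1 - p) := by
    rw [prob_compl_eq_one_sub hTs, hT, ENNReal.ofReal_sub _ hp0, ENNReal.ofReal_one]
  ext B hB
  have hSB : MeasurableSet (ENNReal.ofReal ⁻¹' B) := ENNReal.measurable_ofReal hB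
  rw [Measure.map_apply (Measurable.ite hTs hSm.ennreal_ofReal measurable_const) hB,
    ← measure_inter_add_sdiff _ hTs, add_comm]
  simp only [thinnedLaw, Measure.add_apply, Measure.smul_apply, smul_eq_mul]
  congr 1
  · rw [Measure.dirac_apply' _ hB, ← hTc]
    by_cases h0 : (0 : ℝ≥0∞) ∈ B
    · rw [Set.indicator_of_mem h0, Pi.one_apply, mul_one]
      congr 1; ext ω; by_cases h : T ω = true <;> simp [h, h0]
    · rw [Set.indicator_of_notMem h0, mul_zero]
      convert measure_empty (μ := μ)
      ext ω; by_cases h : T ω = true <;> simp [h, h0]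
  · rw [Measure.map_apply ENNReal.measurable_ofReal hB, ← hS.map_eq, Measure.map_apply hSm hSB,
      ← hT]
    have := hind.measure_inter_preimage_eq_mul {true} _ (measurableSet_singleton _) hSB
    rw [show {ω | T ω = true} = T ⁻¹' {true} from rfl, ← this]
    congr 1; ext ω; by_cases h : T ω = true <;> simp [h]

section ShotNoise

variable {Ω ι : Type*} [MeasurableSpace Ω] [Countable ι] {μ : Measure Ω} [IsProbabilityMeasure μ]

/-- The Laplace transform of a countable weighted sum of independent marks of common law `ν`. -/
lemma lintegral_negExp_tsum_mul {Z : ι → Ω → ℝ≥0∞} {ν : Measure ℝ≥0∞} [IsProbabilityMeasure ν]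
    (hZm : ∀ n, Measurable (Z n)) (hZ : ∀ n, HasLaw (Z n) ν μ) (hind : iIndepFun Z μ)
    (c : ι → ℝ≥0∞) :
    ∫⁻ ω, negExp (∑' n, Z n ω * c n) ∂μ =
      negExp (∑' n, negLog (∫⁻ z, negExp (z * c n) ∂ν)) := by
  have hle : ∀ n, ∫⁻ z, negExp (z * c n) ∂ν ≤ 1 := fun n =>
    (lintegral_mono fun z => negExp_le_one _).trans (by simp)
  have hfin : ∀ s : Finset ι, ∫⁻ ω, negExp (∑ n ∈ s, Z n ω * c n) ∂μ =
      negExp (∑ n ∈ s, negLog (∫⁻ z, negExp (z * c n) ∂ν)) := fun s => by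
    simp_rw [negExp_sum]
    rw [lintegral_prod_eq_prod_lintegral_of_indepFun s (fun n ω => negExp (Z n ω * c n))
      (hind.comp (fun n z => negExp (z * c n)) fun n => by fun_prop)
      fun n => measurable_negExp.comp ((hZm n).mul_const _)]
    refine Finset.prod_congr rfl fun n _ => ?_
    rw [negExp_negLog (hle n)]
    exact (hZ n).lintegral_comp (f := fun z => negExp (z * c n)) (by fun_prop)
  refine tendsto_nhds_unique (tendsto_lintegral_negExp (l := Filter.atTop)
    (f := fun (s : Finset ι) ω => ∑ n ∈ s, Z n ω * c n)
    (fun s => Finset.measurable_sum s fun n _ => (hZm n).mul_const _)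
    fun ω => ENNReal.summable.hasSum) ?_
  simp_rw [hfin]
  exact (continuous_negExp.tendsto _).comp ENNReal.summable.hasSum

/-- The Laplace transform of the shot noise `∑ₙ Zₙ ℓ(Xₙ)` of a Poisson process with independent
marks of law `ν`. -/
lemma IsPoissonPointProcess.laplace_shotNoise {X : ι → Ω → ℝ} {lam : ℝ}
    (hX : IsPoissonPointProcess X lam μ) (hlam : 0 ≤ lam)
    {Z : ι → Ω → ℝ≥0∞} {ν : Measure ℝ≥0∞} [IsProbabilityMeasure ν]
    (hZm : ∀ n, Measurable (Z n)) (hZ : ∀ n, HasLaw (Z n) ν μ) (hind : iIndepFun Z μ)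
    (hXZ : IndepFun (fun ω n => X n ω) (fun ω n => Z n ω) μ)
    {g : ℝ → ℝ≥0∞} (hg : Measurable g) :
    ∫⁻ ω, negExp (∑' n, Z n ω * g (X n ω)) ∂μ =
      negExp (ENNReal.ofReal lam * ∫⁻ y, (1 - ∫⁻ z, negExp (z * g y) ∂ν)) := by
  have hXm : Measurable fun ω n => X n ω := measurable_pi_lambda _ hX.measurable_point
  have hZm' : Measurable fun ω n => Z n ω := measurable_pi_lambda _ hZm
  have hG : Measurable fun y => ∫⁻ z, negExp (z * g y) ∂ν :=
    Measurable.lintegral_prod_right' (f := fun q : ℝ × ℝ≥0∞ => negExp (q.2 * g q.1)) (by fun_prop)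
  have hle : ∀ y, ∫⁻ z, negExp (z * g y) ∂ν ≤ 1 := fun y =>
    (lintegral_mono fun z => negExp_le_one _).trans (by simp)
  have hF : Measurable fun q : (ι → ℝ) × (ι → ℝ≥0∞) => negExp (∑' n, q.2 n * g (q.1 n)) :=
    measurable_negExp.comp (Measurable.tsum fun n => by fun_prop)
  -- by independence, integrate over the marks at fixed positions of the points
  calc ∫⁻ ω, negExp (∑' n, Z n ω * g (X n ω)) ∂μ
      = ∫⁻ q, negExp (∑' n, q.2 n * g (q.1 n))
          ∂(μ.map fun ω => ((fun n => X n ω), fun n => Z n ω)) :=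
        (lintegral_map hF (hXm.prodMk hZm')).symm
    _ = ∫⁻ ω, ∫⁻ ω', negExp (∑' n, Z n ω' * g (X n ω)) ∂μ ∂μ := by
        rw [(indepFun_iff_map_prod_eq_prod_map_map hXm.aemeasurable hZm'.aemeasurable).1 hXZ,
          lintegral_prod _ hF.aemeasurable, lintegral_map hF.lintegral_prod_right' hXm]
        refine lintegral_congr fun ω => lintegral_map (by fun_prop) hZm'
    _ = ∫⁻ ω, negExp (∫⁻ y, negLog (∫⁻ z, negExp (z * g y) ∂ν) ∂(countingMeasure X ω)) ∂μ := by
        refine lintegral_congr fun ω => ?_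
        rw [lintegral_negExp_tsum_mul hZm hZ hind, countingMeasure, lintegral_sum_measure]
        exact congrArg negExp (tsum_congr fun n =>
          (lintegral_dirac' _ (measurable_negLog.comp hG)).symm)
    _ = _ := by
        refine (hX.laplace_functional hlam (measurable_negLog.comp hG)).trans ?_
        simp_rw [Function.comp_apply, negExp_negLog (hle _)]

/-- The Laplace transform of the interference from one road under slotted Aloha. -/
lemma IsPoissonPointProcess.laplace_aloha {X : ι → Ω → ℝ} {lam p : ℝ}
    (hX : IsPoissonPointProcess X lam μ) (hlam : 0 ≤ lam) (hp0 : 0 ≤ p) (hp1 : p ≤ 1)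
    {T : ι → Ω → Bool} {S : ι → Ω → ℝ} {ν : Measure ℝ} [IsProbabilityMeasure ν]
    (hTm : ∀ n, Measurable (T n)) (hSm : ∀ n, Measurable (S n))
    (hT : ∀ n, μ {ω | T n ω = true} = ENNReal.ofReal p) (hS : ∀ n, HasLaw (S n) ν μ)
    (hTS : ∀ n, IndepFun (T n) (S n) μ) (hind : iIndepFun (fun n ω => (T n ω, S n ω)) μ)
    (hXTS : IndepFun (fun ω n => X n ω) (fun ω n => (T n ω, S n ω)) μ)
    {g : ℝ → ℝ≥0∞} (hg : Measurable g) :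
    ∫⁻ ω, negExp (∑' n, if T n ω = true then ENNReal.ofReal (S n ω) * g (X n ω) else 0) ∂μ =
      negExp (ENNReal.ofReal (p * lam) *
        ∫⁻ y, (1 - ∫⁻ x, negExp (ENNReal.ofReal x * g y) ∂ν)) := by
  have := isProbabilityMeasure_thinnedLaw hp0 hp1 ν
  let Z : ι → Ω → ℝ≥0∞ := fun n ω => if T n ω = true then ENNReal.ofReal (S n ω) else 0
  let φ : Bool × ℝ → ℝ≥0∞ := fun q => if q.1 = true then ENNReal.ofReal q.2 else 0
  have hφ : Measurable φ := Measurable.ite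
    (measurable_fst (measurableSet_singleton true)) measurable_snd.ennreal_ofReal measurable_const
  have hmain := hX.laplace_shotNoise hlam (Z := Z) (ν := thinnedLaw p ν)
    (fun n => hφ.comp ((hTm n).prodMk (hSm n)))
    (fun n => hasLaw_thinned hp0 (hTm n) (hSm n) (hT n) (hS n) (hTS n))
    (hind.comp (fun _ => φ) fun _ => hφ)
    (hXTS.comp (φ := id) (ψ := fun (q : ι → Bool × ℝ) n => φ (q n)) measurable_id
      (measurable_pi_lambda _ fun n => hφ.comp (measurable_pi_apply n))) hg
  have hsum : ∀ ω, (∑' n, if T n ω = true then ENNReal.ofReal (S n ω) * g (X n ω) else 0) =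
      ∑' n, Z n ω * g (X n ω) := fun ω => by
    refine tsum_congr fun n => ?_
    by_cases h : T n ω = true <;> simp [Z, h]
  simp_rw [hsum]
  rw [hmain, mul_comm p, ENNReal.ofReal_mul hlam, mul_assoc,
    ← lintegral_const_mul' (ENNReal.ofReal p) _ ENNReal.ofReal_ne_top]
  refine congrArg (fun x => negExp (ENNReal.ofReal lam * x)) (lintegral_congr fun y => ?_)
  have hle : ∫⁻ x, negExp (ENNReal.ofReal x * g y) ∂ν ≤ 1 :=
    (lintegral_mono fun z => negExp_le_one _).trans (by simp)
  rw [thinnedLaw, lintegral_add_measure, lintegral_smul_measure, lintegral_smul_measure,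
    lintegral_dirac' _ (by fun_prop), lintegral_map (by fun_prop) (by fun_prop)]
  simp only [zero_mul, negExp_zero, smul_eq_mul, mul_one]
  refine ENNReal.sub_eq_of_eq_add (ENNReal.add_ne_top.2 ⟨ENNReal.ofReal_ne_top,
    ENNReal.mul_ne_top ENNReal.ofReal_ne_top (hle.trans_lt ENNReal.one_lt_top).ne⟩) ?_
  rw [add_left_comm, ← mul_add, tsub_add_cancel_of_le hle, mul_one,
    ← ENNReal.ofReal_add (sub_nonneg.2 hp1) hp0]
  simp

end ShotNoise

/-! ### Euler's integral for the Gauss hypergeometric function -/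

lemma integrableOn_rpow_Ioc {b : ℝ} (hb : 0 < b) :
    IntegrableOn (fun t : ℝ => t ^ (b - 1)) (Set.Ioc 0 1) := by
  have := intervalIntegral.intervalIntegrable_rpow' (a := 0) (b := 1) (r := b - 1) (by linarith)
  rwa [intervalIntegrable_iff_integrableOn_Ioc_of_le zero_le_one] at this

lemma integral_rpow_Ioc {b : ℝ} (hb : 0 < b) :
    ∫ t in Set.Ioc (0 : ℝ) 1, t ^ (b - 1) = 1 / b := by
  rw [← intervalIntegral.integral_of_le zero_le_one, integral_rpow (Or.inl (by linarith))]
  simp [hb.ne']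

lemma differentiableOn_eulerIntegral (k : ℕ) {b : ℝ} (hb : 0 < b) :
    DifferentiableOn ℂ
      (fun z : ℂ => ∫ t in Set.Ioc (0 : ℝ) 1, ((t ^ (b - 1) : ℝ) : ℂ) * ((1 - z * t) ^ k)⁻¹)
      {z | z.re < 1} := by
  intro z₀ hz₀
  replace hz₀ : z₀.re < 1 := hz₀
  obtain ⟨r, hr0, hr1⟩ := exists_between hz₀
  set δ := min 1 (1 - r) with hδ
  have hδ0 : 0 < δ := lt_min one_pos (by linarith)
  have hlow : ∀ z : ℂ, z.re < r → ∀ t ∈ Set.Ioc (0 : ℝ) 1, δ ≤ ‖1 - z * t‖ := by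
    intro z hz t ht
    refine le_trans ?_ (Complex.re_le_norm _)
    simp only [Complex.sub_re, Complex.one_re, Complex.mul_re, Complex.ofReal_re,
      Complex.ofReal_im, mul_zero, sub_zero]
    rcases le_total z.re 0 with h | h
    · exact (min_le_left _ _).trans (by nlinarith [ht.1])
    · exact (min_le_right _ _).trans (by nlinarith [ht.2])
  have hne : ∀ z : ℂ, z.re < r → ∀ t ∈ Set.Ioc (0 : ℝ) 1, 1 - z * t ≠ 0 := fun z hz t ht h => by
    have := hlow z hz t ht
    rw [h, norm_zero] at this
    linarith
  have hmeas : ∀ z : ℂ, AEStronglyMeasurable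
      (fun t : ℝ => ((t ^ (b - 1) : ℝ) : ℂ) * ((1 - z * t) ^ k)⁻¹)
      (volume.restrict (Set.Ioc (0 : ℝ) 1)) := fun z =>
    Measurable.aestronglyMeasurable (by fun_prop)
  have hs : {z : ℂ | z.re < r} ∈ nhds z₀ :=
    (isOpen_lt Complex.continuous_re continuous_const).mem_nhds hr0
  refine (hasDerivAt_integral_of_dominated_loc_of_deriv_le (𝕜 := ℂ)
    (F' := fun z t => ((t ^ (b - 1) : ℝ) : ℂ) * (k * t * ((1 - z * t) ^ (k + 1))⁻¹))
    (bound := fun t => t ^ (b - 1) * (k * (δ ^ (k + 1))⁻¹)) hs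
    (.of_forall hmeas) ?_ ?_ ?_ ?_ ?_).2.differentiableAt.differentiableWithinAt
  · refine ((integrableOn_rpow_Ioc hb).mul_const (δ ^ k)⁻¹).mono' (hmeas z₀) ?_
    refine (ae_restrict_iff' measurableSet_Ioc).2 (.of_forall fun t ht => ?_)
    rw [norm_mul, norm_inv, norm_pow, Complex.norm_real,
      Real.norm_of_nonneg (Real.rpow_nonneg ht.1.le _)]
    have := hlow z₀ hr0 t ht
    have := Real.rpow_nonneg ht.1.le (b - 1)
    gcongr
  · exact Measurable.aestronglyMeasurable (by fun_prop)
  · refine (ae_restrict_iff' measurableSet_Ioc).2 (.of_forall fun t ht z hz => ?_)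
    rw [norm_mul, norm_mul, norm_mul, norm_inv, norm_pow, Complex.norm_real, Complex.norm_natCast,
      Complex.norm_real, Real.norm_of_nonneg (Real.rpow_nonneg ht.1.le _),
      Real.norm_of_nonneg ht.1.le]
    have := hlow z hz t ht
    have := Real.rpow_nonneg ht.1.le (b - 1)
    have h1 : (k : ℝ) * t ≤ k := mul_le_of_le_one_right (Nat.cast_nonneg k) ht.2
    gcongr
  · exact (integrableOn_rpow_Ioc hb).mul_const _
  · refine (ae_restrict_iff' measurableSet_Ioc).2 (.of_forall fun t ht z hz => ?_)
    have h0 := hne z hz t ht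
    have h1 : HasDerivAt (fun z : ℂ => (1 - z * t) ^ k) (k * (1 - z * t) ^ (k - 1) * -t) z := by
      have := ((hasDerivAt_id z).mul_const (t : ℂ)).const_sub 1
      exact (this.pow k).congr_deriv (by simp)
    refine ((h1.inv (pow_ne_zero k h0)).const_mul _).congr_deriv ?_
    congr 1
    rcases k with _ | k
    · simp
    · simp only [Nat.add_sub_cancel]
      field_simp
      ring

/-- Differentiability in the complex half-plane `Re z < 1` makes the Euler integral real analytic
on `(-∞, 1)`. -/
lemma analyticOnNhd_eulerIntegral (k : ℕ) {b : ℝ} (hb : 0 < b) :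
    AnalyticOnNhd ℝ (fun z : ℝ => ∫ t in Set.Ioc (0 : ℝ) 1, t ^ (b - 1) * ((1 - z * t) ^ k)⁻¹)
      (Set.Iio 1) := by
  have h := ((differentiableOn_eulerIntegral k hb).analyticOnNhd
    (isOpen_lt Complex.continuous_re continuous_const))
  intro z hz
  refine (AnalyticAt.re_ofReal (h z (by simpa using hz))).congr (.of_forall fun x => ?_)
  have : ∀ t : ℝ, ((t ^ (b - 1) : ℝ) : ℂ) * ((1 - (x : ℂ) * t) ^ k)⁻¹ =
      ((t ^ (b - 1) * ((1 - x * t) ^ k)⁻¹ : ℝ) : ℂ) := fun t => by push_cast; ring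
  simp only [this]
  rw [integral_complex_ofReal, Complex.ofReal_re]

/-- The coefficients of the Gauss series with parameters `k`, `b`, `b + 1`. -/
lemma ordinaryHypergeometric_coeff_succ (k n : ℕ) {b : ℝ} (hb : 0 < b) :
    (n.factorial : ℝ)⁻¹ * (ascPochhammer ℝ n).eval ((k + 1 : ℕ) : ℝ) * (ascPochhammer ℝ n).eval b *
      ((ascPochhammer ℝ n).eval (1 + b))⁻¹ = b * ((n + k).choose k * (1 / (n + b))) := by
  have h1 : (ascPochhammer ℝ n).eval ((k + 1 : ℕ) : ℝ) = n.factorial * (n + k).choose k := by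
    rw [← ascPochhammer_eval_cast, ascPochhammer_nat_eq_ascFactorial,
      Nat.ascFactorial_eq_factorial_mul_choose, add_comm n k, Nat.choose_symm_add]
    push_cast; ring
  have h2 : (ascPochhammer ℝ n).eval b * (b + n) = b * (ascPochhammer ℝ n).eval (1 + b) := by
    rw [← ascPochhammer_succ_eval, ascPochhammer_succ_left]
    simp [add_comm]
  have h3 : 0 < (ascPochhammer ℝ n).eval (1 + b) := ascPochhammer_pos n _ (by linarith)
  have h4 : (n.factorial : ℝ) ≠ 0 := by positivity
  have h5 : (n : ℝ) + b ≠ 0 := by positivity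
  rw [h1]
  field_simp
  linear_combination ((n + k).choose k : ℝ) * h2

lemma eulerIntegral_eq_ordinaryHypergeometric {k : ℕ} (hk : 1 ≤ k) {b : ℝ} (hb : 0 < b)
    {z : ℝ} (hz : |z| < 1) :
    b * ∫ t in Set.Ioc (0 : ℝ) 1, t ^ (b - 1) * ((1 - z * t) ^ k)⁻¹ =
      ordinaryHypergeometric (k : ℝ) b (1 + b) z := by
  obtain ⟨k, rfl⟩ := Nat.exists_eq_add_of_le' hk
  let f : ℕ → ℝ → ℝ := fun n t => ((n + k).choose k : ℝ) * z ^ n * t ^ ((n + b) - 1)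
  have hnb : ∀ n : ℕ, 0 < (n : ℝ) + b := fun n => by positivity
  have hint : ∀ n, IntegrableOn (f n) (Set.Ioc 0 1) := fun n =>
    (integrableOn_rpow_Ioc (hnb n)).const_mul _
  have hval : ∀ n, ∫ t in Set.Ioc (0 : ℝ) 1, f n t =
      ((n + k).choose k : ℝ) * z ^ n * (1 / (n + b)) := fun n => by
    rw [integral_const_mul, integral_rpow_Ioc (hnb n)]
  have hnorm : ∀ n, ∫ t in Set.Ioc (0 : ℝ) 1, ‖f n t‖ =
      ((n + k).choose k : ℝ) * |z| ^ n * (1 / (n + b)) := fun n => by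
    rw [← integral_rpow_Ioc (hnb n), ← integral_const_mul]
    refine setIntegral_congr_fun measurableSet_Ioc fun t ht => ?_
    simp only [f, norm_mul, norm_pow, Real.norm_eq_abs, Nat.abs_cast,
      abs_of_nonneg (Real.rpow_nonneg ht.1.le _)]
  have hsum : Summable fun n => ∫ t in Set.Ioc (0 : ℝ) 1, ‖f n t‖ := by
    simp_rw [hnorm]
    refine Summable.of_nonneg_of_le (fun n => by have := hnb n; positivity) (fun n => ?_)
      ((summable_choose_mul_geometric_of_norm_lt_one k (r := |z|) (by simpa using hz)).mul_right
        (1 / b))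
    gcongr
    simp
  have hmain := hasSum_integral_of_summable_integral_norm hint hsum
  have hpt : ∀ t ∈ Set.Ioc (0 : ℝ) 1,
      ∑' n, f n t = t ^ (b - 1) * ((1 - z * t) ^ (k + 1))⁻¹ := fun t ht => by
    have hzt : ‖z * t‖ < 1 := by
      rw [norm_mul, Real.norm_eq_abs, Real.norm_of_nonneg ht.1.le]
      exact (mul_le_of_le_one_right (abs_nonneg z) ht.2).trans_lt hz
    rw [← one_div, ← tsum_choose_mul_geometric_of_norm_lt_one k hzt, ← tsum_mul_left]
    refine tsum_congr fun n => ?_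
    simp only [f]
    rw [add_sub_assoc, Real.rpow_add ht.1, Real.rpow_natCast, mul_pow]
    ring
  rw [setIntegral_congr_fun measurableSet_Ioc hpt] at hmain
  rw [← hmain.tsum_eq, ← tsum_mul_left, ordinaryHypergeometric_eq_tsum]
  refine tsum_congr fun n => ?_
  rw [hval, ordinaryHypergeometric_coeff_succ k n hb, smul_eq_mul]
  ring

/-- Euler's integral for the Gauss hypergeometric function with parameters `k`, `b`, `b + 1`. -/
lemma gaussHypergeometric_eq_eulerIntegral {k : ℕ} (hk : 1 ≤ k) {b : ℝ} (hb : 0 < b)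
    {z : ℝ} (hz : z < 1) :
    gaussHypergeometric k b (1 + b) z =
      b * ∫ t in Set.Ioc (0 : ℝ) 1, t ^ (b - 1) * ((1 - z * t) ^ k)⁻¹ := by
  let F : ℝ → ℝ := fun z => b * ∫ t in Set.Ioc (0 : ℝ) 1, t ^ (b - 1) * ((1 - z * t) ^ k)⁻¹
  have hF : IsGaussHypergeometric k b (1 + b) F :=
    ⟨analyticOnNhd_const.mul (analyticOnNhd_eulerIntegral k hb),
      fun z hz => eulerIntegral_eq_ordinaryHypergeometric hk hb hz⟩
  have hex : ∃ F, IsGaussHypergeometric k b (1 + b) F := ⟨F, hF⟩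
  rw [gaussHypergeometric, dif_pos hex]
  -- both functions are analytic on the interval `(-∞, 1)` and agree near `0`
  refine hex.choose_spec.1.eqOn_of_preconnected_of_eventuallyEq hF.1 isPreconnected_Iio
    (z₀ := 0) (by simp) ?_ hz
  filter_upwards [Metric.ball_mem_nhds (0 : ℝ) one_pos] with x hx
  have hx' : |x| < 1 := by simpa using hx
  rw [hex.choose_spec.2 x hx', hF.2 x hx']

/-! ### Beta integrals of the second kind and the path-loss integral -/

lemma lintegral_rpow_mul_exp_neg_mul_Ioi {a r : ℝ} (ha : 0 < a) (hr : 0 < r) :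
    ∫⁻ t in Set.Ioi (0 : ℝ), ENNReal.ofReal (t ^ (a - 1) * Real.exp (-(r * t))) =
      ENNReal.ofReal ((1 / r) ^ a * Real.Gamma a) := by
  have h := Real.integral_rpow_mul_exp_neg_mul_Ioi ha hr
  have hpos : 0 < (1 / r) ^ a * Real.Gamma a :=
    mul_pos (Real.rpow_pos_of_pos (by positivity) _) (Real.Gamma_pos_of_pos ha)
  rw [← h, ofReal_integral_eq_lintegral_ofReal]
  · exact Integrable.of_integral_ne_zero (by rw [h]; exact hpos.ne')
  · exact (ae_restrict_iff' measurableSet_Ioi).2 (.of_forall fun t ht =>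
      mul_nonneg (Real.rpow_nonneg (le_of_lt ht) _) (Real.exp_pos _).le)

/-- Writing `(1 + t)⁻ᵏ` as a Gamma integral and exchanging the integrals turns the Beta integral
of the second kind into a product of two Gamma integrals. -/
lemma lintegral_beta_second_kind {k : ℕ} {b : ℝ} (hb : 0 < b) (hbk : b < k) :
    ∫⁻ t in Set.Ioi (0 : ℝ), ENNReal.ofReal (t ^ (b - 1) * ((1 + t) ^ k)⁻¹) =
      ENNReal.ofReal (Real.Gamma b * Real.Gamma (k - b) / Real.Gamma k) := by
  have hk : (0 : ℝ) < k := hb.trans hbk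
  have hΓ := Real.Gamma_pos_of_pos hk
  have h1 : ∀ t ∈ Set.Ioi (0 : ℝ), ENNReal.ofReal (t ^ (b - 1) * ((1 + t) ^ k)⁻¹) =
      ∫⁻ x in Set.Ioi (0 : ℝ), ENNReal.ofReal ((Real.Gamma k)⁻¹ *
        (t ^ (b - 1) * (x ^ ((k : ℝ) - 1) * Real.exp (-((1 + t) * x))))) := fun t ht => by
    have ht : 0 < t := ht
    have h0 : 0 ≤ (Real.Gamma k)⁻¹ * t ^ (b - 1) := by positivity
    simp_rw [← mul_assoc ((Real.Gamma k)⁻¹), ENNReal.ofReal_mul h0]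
    rw [lintegral_const_mul' _ _ ENNReal.ofReal_ne_top,
      lintegral_rpow_mul_exp_neg_mul_Ioi hk (by positivity), ← ENNReal.ofReal_mul h0,
      Real.rpow_natCast, one_div, inv_pow]
    congr 1
    field_simp
  have h2 : ∀ x ∈ Set.Ioi (0 : ℝ), ∫⁻ t in Set.Ioi (0 : ℝ), ENNReal.ofReal ((Real.Gamma k)⁻¹ *
        (t ^ (b - 1) * (x ^ ((k : ℝ) - 1) * Real.exp (-((1 + t) * x))))) =
      ENNReal.ofReal (Real.Gamma b / Real.Gamma k) *
        ENNReal.ofReal (x ^ ((k - b) - 1) * Real.exp (-(1 * x))) := fun x hx => by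
    have hx : 0 < x := hx
    have h0 : 0 ≤ (Real.Gamma k)⁻¹ * (x ^ ((k : ℝ) - 1) * Real.exp (-x)) := by positivity
    have h3 : ∀ t : ℝ, ENNReal.ofReal ((Real.Gamma k)⁻¹ *
        (t ^ (b - 1) * (x ^ ((k : ℝ) - 1) * Real.exp (-((1 + t) * x))))) =
        ENNReal.ofReal ((Real.Gamma k)⁻¹ * (x ^ ((k : ℝ) - 1) * Real.exp (-x))) *
          ENNReal.ofReal (t ^ (b - 1) * Real.exp (-(x * t))) := fun t => by
      rw [← ENNReal.ofReal_mul h0, show -((1 + t) * x) = -x + -(x * t) by ring, Real.exp_add]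
      congr 1; ring
    simp_rw [h3]
    rw [lintegral_const_mul' _ _ ENNReal.ofReal_ne_top, lintegral_rpow_mul_exp_neg_mul_Ioi hb hx,
      ← ENNReal.ofReal_mul h0,
      ← ENNReal.ofReal_mul (div_nonneg (Real.Gamma_pos_of_pos hb).le hΓ.le), one_div,
      Real.inv_rpow hx.le, sub_right_comm, Real.rpow_sub hx ((k : ℝ) - 1) b, one_mul]
    congr 1
    field_simp
  rw [setLIntegral_congr_fun measurableSet_Ioi h1, lintegral_lintegral_swap (by fun_prop),
    setLIntegral_congr_fun measurableSet_Ioi h2, lintegral_const_mul' _ _ ENNReal.ofReal_ne_top,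
    lintegral_rpow_mul_exp_neg_mul_Ioi (sub_pos.2 hbk) one_pos,
    ← ENNReal.ofReal_mul (div_nonneg (Real.Gamma_pos_of_pos hb).le hΓ.le)]
  congr 1
  simp
  ring

lemma integrableOn_beta_second_kind {k : ℕ} {b : ℝ} (hb : 0 < b) (hbk : b < k) :
    IntegrableOn (fun t : ℝ => t ^ (b - 1) * ((1 + t) ^ k)⁻¹) (Set.Ioi 0) := by
  refine ⟨Measurable.aestronglyMeasurable (by fun_prop), ?_⟩
  rw [hasFiniteIntegral_iff_ofReal, lintegral_beta_second_kind hb hbk]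
  · exact ENNReal.ofReal_lt_top
  · exact (ae_restrict_iff' measurableSet_Ioi).2 (.of_forall fun t (ht : 0 < t) => by positivity)

lemma integral_beta_second_kind {k : ℕ} {b : ℝ} (hb : 0 < b) (hbk : b < k) :
    ∫ t in Set.Ioi (0 : ℝ), t ^ (b - 1) * ((1 + t) ^ k)⁻¹ =
      Real.Gamma b * Real.Gamma (k - b) / Real.Gamma k := by
  have h := Real.Gamma_pos_of_pos hb
  have h' := Real.Gamma_pos_of_pos (sub_pos.2 hbk)
  have h'' := Real.Gamma_pos_of_pos (hb.trans hbk)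
  rw [integral_eq_lintegral_of_nonneg_ae, lintegral_beta_second_kind hb hbk,
    ENNReal.toReal_ofReal (by positivity)]
  · exact (ae_restrict_iff' measurableSet_Ioi).2 (.of_forall fun t (ht : 0 < t) => by positivity)
  · exact Measurable.aestronglyMeasurable (by fun_prop)

section RationalPowers

variable {k : ℕ} {b c : ℝ}

lemma rpow_mul_beta_second_kind (hc : 0 < c) {t : ℝ} (ht : 0 ≤ t) :
    (c * t) ^ (b - 1) * ((1 + c * t / c) ^ k)⁻¹ =
      c ^ (b - 1) * (t ^ (b - 1) * ((1 + t) ^ k)⁻¹) := by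
  rw [Real.mul_rpow hc.le ht, mul_div_cancel_left₀ _ hc.ne', mul_assoc]

lemma integrableOn_rpow_mul_inv_pow (hb : 0 < b) (hbk : b < k) (hc : 0 < c) :
    IntegrableOn (fun y : ℝ => y ^ (b - 1) * ((1 + y / c) ^ k)⁻¹) (Set.Ioi 0) := by
  rw [← mul_zero c, ← integrableOn_Ioi_comp_mul_left_iff _ _ hc]
  exact IntegrableOn.congr_fun ((integrableOn_beta_second_kind hb hbk).const_mul (c ^ (b - 1)))
    (fun t ht => (rpow_mul_beta_second_kind hc (le_of_lt ht)).symm) measurableSet_Ioi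

lemma integral_rpow_mul_inv_pow (hb : 0 < b) (hbk : b < k) (hc : 0 < c) :
    ∫ y in Set.Ioi (0 : ℝ), y ^ (b - 1) * ((1 + y / c) ^ k)⁻¹ =
      c ^ b * (Real.Gamma b * Real.Gamma (k - b) / Real.Gamma k) := by
  have h := integral_comp_mul_left_Ioi (fun y : ℝ => y ^ (b - 1) * ((1 + y / c) ^ k)⁻¹) 0 hc
  rw [mul_zero, setIntegral_congr_fun measurableSet_Ioi
    (fun t ht => rpow_mul_beta_second_kind hc (le_of_lt ht)), integral_const_mul,
    integral_beta_second_kind hb hbk, smul_eq_mul] at h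
  rw [eq_comm, inv_mul_eq_iff_eq_mul₀ hc.ne'] at h
  rw [h, Real.rpow_sub hc, Real.rpow_one]
  field_simp

lemma integral_Ioc_rpow_mul_inv_pow (hk : 1 ≤ k) (hb : 0 < b) (hc : 0 < c) {D : ℝ} (hD : 0 ≤ D) :
    ∫ y in Set.Ioc (0 : ℝ) D, y ^ (b - 1) * ((1 + y / c) ^ k)⁻¹ =
      D ^ b / b * gaussHypergeometric k b (1 + b) (-(D / c)) := by
  rcases hD.eq_or_lt with rfl | hD
  · simp [Real.zero_rpow hb.ne']
  rw [gaussHypergeometric_eq_eulerIntegral hk hb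
    (lt_of_le_of_lt (neg_nonpos.2 (by positivity)) one_pos),
    ← intervalIntegral.integral_of_le hD.le, ← intervalIntegral.integral_of_le zero_le_one]
  have h := intervalIntegral.smul_integral_comp_mul_left (a := 0) (b := 1)
    (fun y : ℝ => y ^ (b - 1) * ((1 + y / c) ^ k)⁻¹) D
  rw [mul_zero, mul_one] at h
  have h2 : ∫ t in (0 : ℝ)..1, (D * t) ^ (b - 1) * ((1 + D * t / c) ^ k)⁻¹ =
      ∫ t in (0 : ℝ)..1, D ^ (b - 1) * (t ^ (b - 1) * ((1 - -(D / c) * t) ^ k)⁻¹) := by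
    refine intervalIntegral.integral_congr fun t ht => ?_
    rw [Set.uIcc_of_le zero_le_one] at ht
    rw [Real.mul_rpow hD.le ht.1, mul_assoc]
    congr 4; ring
  rw [← h, h2, intervalIntegral.integral_const_mul, Real.rpow_sub hD, Real.rpow_one, smul_eq_mul]
  field_simp

lemma integral_Ioi_rpow_mul_inv_pow (hk : 1 ≤ k) (hb : 0 < b) (hbk : b < k) (hc : 0 < c)
    {D : ℝ} (hD : 0 ≤ D) :
    ∫ y in Set.Ioi D, y ^ (b - 1) * ((1 + y / c) ^ k)⁻¹ =
      c ^ b * (Real.Gamma b * Real.Gamma (k - b) / Real.Gamma k) -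
        D ^ b / b * gaussHypergeometric k b (1 + b) (-(D / c)) := by
  have hint := integrableOn_rpow_mul_inv_pow hb hbk hc
  rw [← integral_rpow_mul_inv_pow hb hbk hc, ← integral_Ioc_rpow_mul_inv_pow hk hb hc hD,
    ← Set.Ioc_union_Ioi_eq_Ioi hD, setIntegral_union (Set.Ioc_disjoint_Ioi le_rfl)
      measurableSet_Ioi (hint.mono_set Set.Ioc_subset_Ioi_self)
      (hint.mono_set (Set.Ioi_subset_Ioi hD))]
  ring

end RationalPowers

section PathLoss

variable {k : ℕ} {α c d : ℝ}

/-- The integral over `(d, ∞)` of `1 - (1 + c r⁻ᵅ)⁻ᵏ`, in closed form. With `c = A s θ` the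
integrand is one minus the Laplace transform at `s` of the power received from distance `r`. -/
noncomputable def halfLineExponent (k : ℕ) (α d c : ℝ) : ℝ :=
  ∑ q ∈ Finset.range k,
    (k.choose q : ℝ) * (1 / (α * Real.Gamma k)) * c ^ (-(q : ℝ)) * Real.Gamma (1 / α + q) *
      (c ^ (1 / α + q) * Real.Gamma (-(1 / α) + k - q) -
        d ^ (1 + α * q) * Real.Gamma k *
          regGaussHypergeometric k (1 / α + q) (1 + 1 / α + q) (-(d ^ α / c)))

lemma one_div_add_natCast_pos (hα : 1 < α) (q : ℕ) : 0 < 1 / α + q := by positivity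

lemma one_div_add_natCast_lt (hα : 1 < α) {q : ℕ} (hq : q < k) : 1 / α + q < k := by
  have h1 : 1 / α < 1 := by rw [div_lt_one (by linarith)]; exact hα
  have h2 : (q : ℝ) + 1 ≤ k := by exact_mod_cast hq
  linarith

/-- The substitution `y = rᵅ`. -/
lemma rpow_substitution (hα : 1 < α) (q : ℕ) {r : ℝ} (hr : 0 < r) :
    (α * r ^ (α - 1)) • ((r ^ α) ^ (1 / α + q - 1) * ((1 + r ^ α / c) ^ k)⁻¹) =
      α * (r ^ (α * q) * ((1 + r ^ α / c) ^ k)⁻¹) := by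
  have hα0 : α ≠ 0 := by positivity
  rw [smul_eq_mul, mul_assoc, ← mul_assoc (r ^ (α - 1)), ← Real.rpow_mul hr.le, ← Real.rpow_add hr]
  congr 4
  field_simp
  ring

lemma integrableOn_rpow_mul_inv_pow_rpow (hα : 1 < α) (hc : 0 < c) (hd : 0 ≤ d) {q : ℕ}
    (hq : q < k) :
    IntegrableOn (fun r : ℝ => r ^ (α * q) * ((1 + r ^ α / c) ^ k)⁻¹) (Set.Ioi d) := by
  have hα0 : α ≠ 0 := by positivity
  have h := (integrableOn_Ioi_comp_rpow_iff
    (fun y : ℝ => y ^ (1 / α + q - 1) * ((1 + y / c) ^ k)⁻¹) hα0).2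
    (integrableOn_rpow_mul_inv_pow (one_div_add_natCast_pos hα q) (one_div_add_natCast_lt hα hq) hc)
  rw [abs_of_pos (by positivity)] at h
  refine IntegrableOn.mono_set ?_ (Set.Ioi_subset_Ioi hd)
  refine IntegrableOn.congr_fun (h.const_mul α⁻¹) (fun r hr => ?_) measurableSet_Ioi
  rw [rpow_substitution hα q hr, inv_mul_cancel_left₀ hα0]

lemma integral_rpow_mul_inv_pow_rpow (hα : 1 < α) (hc : 0 < c) (hd : 0 ≤ d) {q : ℕ}
    (hq : q < k) :
    ∫ r in Set.Ioi d, r ^ (α * q) * ((1 + r ^ α / c) ^ k)⁻¹ =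
      1 / (α * Real.Gamma k) * Real.Gamma (1 / α + q) *
      (c ^ (1 / α + q) * Real.Gamma (-(1 / α) + k - q) -
        d ^ (1 + α * q) * Real.Gamma k *
          regGaussHypergeometric k (1 / α + q) (1 + 1 / α + q) (-(d ^ α / c))) := by
  have hα0 : α ≠ 0 := by positivity
  have hb := one_div_add_natCast_pos hα q
  have hk : 1 ≤ k := by omega
  have hΓk : Real.Gamma k ≠ 0 := (Real.Gamma_pos_of_pos (by exact_mod_cast hk)).ne'
  have hΓb : Real.Gamma (1 / α + q) ≠ 0 := (Real.Gamma_pos_of_pos hb).ne'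
  have h := integral_comp_rpow_Ioi_of_pos' (p := α)
    (g := fun y : ℝ => y ^ (1 / α + q - 1) * ((1 + y / c) ^ k)⁻¹) (by positivity)
    (Real.rpow_nonneg hd α)
  rw [← Real.rpow_mul hd α α⁻¹, mul_inv_cancel₀ hα0, Real.rpow_one,
    setIntegral_congr_fun measurableSet_Ioi
    (fun r hr => rpow_substitution hα q (lt_of_le_of_lt hd hr)), integral_const_mul,
    integral_Ioi_rpow_mul_inv_pow hk hb (one_div_add_natCast_lt hα hq) hc
      (Real.rpow_nonneg hd α), ← Real.rpow_mul hd] at h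
  rw [regGaussHypergeometric, show 1 + 1 / α + (q : ℝ) = 1 + (1 / α + q) by ring,
    add_comm 1 (1 / α + (q : ℝ)), Real.Gamma_add_one hb.ne', add_comm (1 / α + (q : ℝ)) 1,
    show -(1 / α) + (k : ℝ) - q = k - (1 / α + q) by ring,
    show 1 + α * (q : ℝ) = α * (1 / α + q) by field_simp, eq_comm]
  rw [← mul_right_inj' hα0, h]
  field_simp

/-- With `u = rᵅ` the left side is `((u + c)ᵏ - uᵏ) / (u + c)ᵏ`, and the binomial theorem applies to
the numerator. -/
lemma one_sub_inv_pow_eq_sum (hc : 0 < c) {r : ℝ} (hr : 0 < r) (α : ℝ) (k : ℕ) :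
    1 - ((1 + c * r ^ (-α)) ^ k)⁻¹ = ∑ q ∈ Finset.range k, ((k.choose q : ℝ) * c ^ (-(q : ℝ))) *
      (r ^ (α * q) * ((1 + r ^ α / c) ^ k)⁻¹) := by
  have hu : 0 < r ^ α := Real.rpow_pos_of_pos hr α
  have h1 : (1 + c * r ^ (-α)) ^ k = (r ^ α)⁻¹ ^ k * (r ^ α + c) ^ k := by
    rw [← mul_pow, Real.rpow_neg hr.le]; congr 1; field_simp
  have h2 : (1 + r ^ α / c) ^ k = c⁻¹ ^ k * (r ^ α + c) ^ k := by
    rw [← mul_pow]; congr 1; field_simp; ring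
  have h3 : ∀ q ∈ Finset.range k, ((k.choose q : ℝ) * c ^ (-(q : ℝ))) *
      (r ^ (α * q) * ((1 + r ^ α / c) ^ k)⁻¹) =
      ((r ^ α) ^ q * c ^ (k - q) * k.choose q) / (r ^ α + c) ^ k := fun q hq => by
    have hq : q ≤ k := (Finset.mem_range.1 hq).le
    rw [h2, Real.rpow_mul_natCast hr.le, Real.rpow_neg hc.le, Real.rpow_natCast,
      pow_sub₀ c hc.ne' hq, inv_pow]
    field_simp
  have h4 := add_pow (r ^ α) c k
  rw [Finset.sum_range_succ] at h4
  simp only [Nat.sub_self, pow_zero, mul_one, Nat.choose_self, Nat.cast_one] at h4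
  rw [Finset.sum_congr rfl h3, ← Finset.sum_div, ← sub_eq_of_eq_add h4, h1, inv_pow]
  have : 0 < r ^ α + c := by positivity
  field_simp

lemma one_sub_inv_pow_nonneg (hc : 0 ≤ c) {r : ℝ} (hr : 0 ≤ r) (α : ℝ) (k : ℕ) :
    0 ≤ 1 - ((1 + c * r ^ (-α)) ^ k)⁻¹ :=
  sub_nonneg.2 (inv_le_one_of_one_le₀ (one_le_pow₀ (by
    rw [le_add_iff_nonneg_right]; positivity)))

lemma integrableOn_one_sub_inv_pow (k : ℕ) (hα : 1 < α) (hc : 0 < c) (hd : 0 ≤ d) :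
    IntegrableOn (fun r : ℝ => 1 - ((1 + c * r ^ (-α)) ^ k)⁻¹) (Set.Ioi d) :=
  IntegrableOn.congr_fun (integrable_finsetSum _ fun _ hq =>
      (integrableOn_rpow_mul_inv_pow_rpow hα hc hd (Finset.mem_range.1 hq)).const_mul _)
    (fun _ hr => (one_sub_inv_pow_eq_sum hc (lt_of_le_of_lt hd hr) α k).symm) measurableSet_Ioi

lemma integral_one_sub_inv_pow (k : ℕ) (hα : 1 < α) (hc : 0 < c) (hd : 0 ≤ d) :
    ∫ r in Set.Ioi d, (1 - ((1 + c * r ^ (-α)) ^ k)⁻¹) = halfLineExponent k α d c := by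
  rw [setIntegral_congr_fun measurableSet_Ioi fun r hr =>
      one_sub_inv_pow_eq_sum hc (lt_of_le_of_lt hd hr) α k,
    integral_finsetSum _ fun q hq => (integrableOn_rpow_mul_inv_pow_rpow hα hc hd
      (Finset.mem_range.1 hq)).const_mul _, halfLineExponent]
  refine Finset.sum_congr rfl fun q hq => ?_
  rw [integral_const_mul, integral_rpow_mul_inv_pow_rpow hα hc hd (Finset.mem_range.1 hq)]
  ring

lemma halfLineExponent_nonneg (k : ℕ) (hα : 1 < α) (hc : 0 < c) (hd : 0 ≤ d) :
    0 ≤ halfLineExponent k α d c := by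
  rw [← integral_one_sub_inv_pow k hα hc hd]
  exact setIntegral_nonneg measurableSet_Ioi fun r hr =>
    one_sub_inv_pow_nonneg hc.le (hd.trans (le_of_lt hr)) α k

lemma halfLineExponent_le (k : ℕ) (hα : 1 < α) (hc : 0 < c) (hd : 0 ≤ d) :
    halfLineExponent k α d c ≤ halfLineExponent k α 0 c := by
  rw [← integral_one_sub_inv_pow k hα hc hd, ← integral_one_sub_inv_pow k hα hc le_rfl]
  exact setIntegral_mono_set (integrableOn_one_sub_inv_pow k hα hc le_rfl)
    ((ae_restrict_iff' measurableSet_Ioi).2 (.of_forall fun r hr =>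
      one_sub_inv_pow_nonneg hc.le (le_of_lt hr) α k))
    (Set.Ioi_subset_Ioi hd).eventuallyLE

lemma lintegral_one_sub_inv_pow (k : ℕ) (hα : 1 < α) (hc : 0 < c) (hd : 0 ≤ d) :
    ∫⁻ r in Set.Ioi d, ENNReal.ofReal (1 - ((1 + c * r ^ (-α)) ^ k)⁻¹) =
      ENNReal.ofReal (halfLineExponent k α d c) := by
  rw [← integral_one_sub_inv_pow k hα hc hd, ← ofReal_integral_eq_lintegral_ofReal
    (integrableOn_one_sub_inv_pow k hα hc hd)]
  exact (ae_restrict_iff' measurableSet_Ioi).2 (.of_forall fun r hr =>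
    one_sub_inv_pow_nonneg hc.le (hd.trans (le_of_lt hr)) α k)

lemma halfLineExponent_zero (hα : 1 < α) (hc : 0 < c) :
    halfLineExponent k α 0 c = c ^ (1 / α) * halfLineExponent k α 0 1 := by
  rw [halfLineExponent, halfLineExponent, Finset.mul_sum]
  refine Finset.sum_congr rfl fun q _ => ?_
  have : 1 + α * (q : ℝ) ≠ 0 := by positivity
  rw [Real.zero_rpow this, Real.rpow_neg hc.le, Real.rpow_add hc]
  have := Real.rpow_pos_of_pos hc q
  simp
  field_simp

/-- Euler's reflection formula evaluates the exponent of the receiver's own road. -/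
lemma halfLineExponent_one_zero (hα : 1 < α) :
    halfLineExponent 1 α 0 1 = Real.pi / α * (1 / Real.sin (Real.pi / α)) := by
  have h := Real.Gamma_mul_Gamma_one_sub (1 / α)
  rw [mul_one_div] at h
  simp only [halfLineExponent, Finset.sum_range_one, Nat.cast_zero, Nat.cast_one, Real.one_rpow,
    Real.Gamma_one, mul_zero, add_zero, Real.rpow_one, zero_mul, sub_zero, Nat.choose_zero_right,
    one_mul, mul_one, neg_add_eq_sub]
  rw [mul_assoc, h]
  field_simp

end PathLoss

/-! ### The Erlang law -/

section Erlang

variable {k : ℕ} {θ : ℝ}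

lemma erlangLaw_eq_withDensity (k : ℕ) (θ : ℝ) :
    erlangLaw k θ = (volume.restrict (Set.Ioi 0)).withDensity fun x =>
      ENNReal.ofReal
        (θ⁻¹ ^ (k : ℝ) / Real.Gamma k * x ^ ((k : ℝ) - 1) * Real.exp (-(θ⁻¹ * x))) := by
  rw [erlangLaw, gammaMeasure, ← withDensity_indicator measurableSet_Ioi]
  refine withDensity_congr_ae ?_
  filter_upwards [(measure_eq_zero_iff_ae_notMem.1 (measure_singleton (μ := volume) (0 : ℝ)))]
    with x hx
  rcases lt_trichotomy x 0 with h | h | h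
  · rw [gammaPDF_of_neg h, Set.indicator_of_notMem (by simpa using h.le)]
  · exact absurd h hx
  · rw [gammaPDF_of_nonneg h.le, Set.indicator_of_mem (by simpa using h)]

lemma isProbabilityMeasure_erlangLaw (hk : 1 ≤ k) (hθ : 0 < θ) :
    IsProbabilityMeasure (erlangLaw k θ) :=
  isProbabilityMeasure_gammaMeasure (by exact_mod_cast hk) (inv_pos.2 hθ)

lemma lintegral_negExp_erlangLaw (hk : 1 ≤ k) (hθ : 0 < θ) {c : ℝ} (hc : 0 ≤ c) :
    ∫⁻ x, negExp (ENNReal.ofReal x * ENNReal.ofReal c) ∂(erlangLaw k θ) =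
      ENNReal.ofReal ((1 + θ * c) ^ k)⁻¹ := by
  have hk0 : (0 : ℝ) < k := by exact_mod_cast hk
  have hΓ := Real.Gamma_pos_of_pos hk0
  have h0 : 0 ≤ θ⁻¹ ^ (k : ℝ) / Real.Gamma k := by positivity
  rw [erlangLaw_eq_withDensity,
    lintegral_withDensity_eq_lintegral_mul _ (by fun_prop) (by fun_prop)]
  have h : ∀ x ∈ Set.Ioi (0 : ℝ), ((fun x => ENNReal.ofReal
      (θ⁻¹ ^ (k : ℝ) / Real.Gamma k * x ^ ((k : ℝ) - 1) * Real.exp (-(θ⁻¹ * x)))) *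
      fun x => negExp (ENNReal.ofReal x * ENNReal.ofReal c)) x =
      ENNReal.ofReal (θ⁻¹ ^ (k : ℝ) / Real.Gamma k) *
        ENNReal.ofReal (x ^ ((k : ℝ) - 1) * Real.exp (-((θ⁻¹ + c) * x))) := fun x hx => by
    have hx : 0 < x := hx
    rw [Pi.mul_apply, ← ENNReal.ofReal_mul hx.le, negExp_ofReal (by positivity),
      ← ENNReal.ofReal_mul (by positivity), ← ENNReal.ofReal_mul h0,
      show -((θ⁻¹ + c) * x) = -(θ⁻¹ * x) + -(x * c) by ring, Real.exp_add]
    congr 1; ring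
  rw [setLIntegral_congr_fun measurableSet_Ioi h, lintegral_const_mul' _ _ ENNReal.ofReal_ne_top,
    lintegral_rpow_mul_exp_neg_mul_Ioi hk0 (by positivity), ← ENNReal.ofReal_mul h0]
  congr 1
  rw [Real.rpow_natCast, Real.rpow_natCast, one_div, inv_pow, inv_pow,
    show 1 + θ * c = θ * (θ⁻¹ + c) by field_simp, mul_pow]
  field_simp

/-- The derivative of the truncated exponential series telescopes against that of `e⁻ᵘ`. -/
lemma hasDerivAt_exp_neg_mul_sum (k : ℕ) (u : ℝ) :
    HasDerivAt (fun u => -(Real.exp (-u) * ∑ i ∈ Finset.range (k + 1), u ^ i / i.factorial))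
      (Real.exp (-u) * (u ^ k / k.factorial)) u := by
  induction k with
  | zero =>
    simp only [zero_add, Finset.sum_range_one, pow_zero, Nat.factorial_zero, Nat.cast_one, div_one,
      mul_one]
    exact (hasDerivAt_neg u).exp.fun_neg.congr_deriv (by ring)
  | succ k ih =>
    have h1 : HasDerivAt (fun u : ℝ => Real.exp (-u) * (u ^ (k + 1) / (k + 1).factorial))
        (Real.exp (-u) * (u ^ k / k.factorial) -
          Real.exp (-u) * (u ^ (k + 1) / (k + 1).factorial)) u := by
      refine ((hasDerivAt_neg u).exp.fun_mul
        ((hasDerivAt_pow (k + 1) u).div_const _)).congr_deriv ?_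
      rw [Nat.factorial_succ]
      push_cast
      field_simp
      ring
    refine ((ih.fun_sub h1).congr_deriv (by ring)).congr_of_eventuallyEq (.of_forall fun u => ?_)
    beta_reduce
    rw [Finset.sum_range_succ _ (k + 1)]
    ring

/-- The tail of the Erlang law. -/
lemma erlangLaw_Ici (hk : 1 ≤ k) (hθ : 0 < θ) {u : ℝ} (hu : 0 ≤ u) :
    erlangLaw k θ (Set.Ici (θ * u)) =
      ENNReal.ofReal (Real.exp (-u) * ∑ i ∈ Finset.range k, u ^ i / i.factorial) := by
  obtain ⟨k, rfl⟩ := Nat.exists_eq_add_of_le' hk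
  have hderiv : ∀ x ∈ Set.Ici (θ * u), HasDerivAt (fun x => -(Real.exp (-(θ⁻¹ * x)) *
      ∑ i ∈ Finset.range (k + 1), (θ⁻¹ * x) ^ i / i.factorial))
      (Real.exp (-(θ⁻¹ * x)) * ((θ⁻¹ * x) ^ k / k.factorial) * θ⁻¹) x := fun x _ =>
    (hasDerivAt_exp_neg_mul_sum k (θ⁻¹ * x)).comp x
      (by simpa using (hasDerivAt_id x).const_mul θ⁻¹)
  have hpos : ∀ x ∈ Set.Ioi (θ * u),
      0 ≤ Real.exp (-(θ⁻¹ * x)) * ((θ⁻¹ * x) ^ k / k.factorial) * θ⁻¹ := fun x hx => by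
    have : 0 ≤ x := (mul_nonneg hθ.le hu).trans (le_of_lt hx)
    positivity
  have htend : Filter.Tendsto (fun x => -(Real.exp (-(θ⁻¹ * x)) *
      ∑ i ∈ Finset.range (k + 1), (θ⁻¹ * x) ^ i / i.factorial)) Filter.atTop (nhds 0) := by
    have h1 : Filter.Tendsto (fun x : ℝ => -(Real.exp (-x) *
        ∑ i ∈ Finset.range (k + 1), x ^ i / i.factorial)) Filter.atTop (nhds 0) := by
      have h2 := (tendsto_finsetSum (Finset.range (k + 1)) fun i _ =>
        (Real.tendsto_pow_mul_exp_neg_atTop_nhds_zero i).div_const (i.factorial : ℝ)).neg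
      simp only [zero_div, Finset.sum_const_zero, neg_zero] at h2
      refine h2.congr fun x => ?_
      rw [Finset.mul_sum]
      congr 1
      exact Finset.sum_congr rfl fun i _ => by ring
    exact h1.comp (Filter.tendsto_id.const_mul_atTop (inv_pos.2 hθ))
  have hΓ : Real.Gamma ((k + 1 : ℕ) : ℝ) = k.factorial := by
    push_cast; exact Real.Gamma_nat_eq_factorial k
  have hdens : ∀ x ∈ Set.Ioi (θ * u), ENNReal.ofReal (θ⁻¹ ^ ((k + 1 : ℕ) : ℝ) /
      Real.Gamma ((k + 1 : ℕ) : ℝ) * x ^ (((k + 1 : ℕ) : ℝ) - 1) * Real.exp (-(θ⁻¹ * x))) =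
      ENNReal.ofReal (Real.exp (-(θ⁻¹ * x)) * ((θ⁻¹ * x) ^ k / k.factorial) * θ⁻¹) :=
    fun x hx => by
      rw [hΓ, Real.rpow_natCast, show (((k + 1 : ℕ) : ℝ) - 1) = (k : ℕ) by push_cast; ring,
        Real.rpow_natCast, pow_succ, mul_pow]
      congr 1; ring
  have hsub : Set.Ioi (θ * u) ⊆ Set.Ioi 0 := Set.Ioi_subset_Ioi (mul_nonneg hθ.le hu)
  rw [erlangLaw_eq_withDensity, withDensity_apply _ measurableSet_Ici, Measure.restrict_restrict
    measurableSet_Ici]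
  have hset : (Set.Ici (θ * u) ∩ Set.Ioi 0 : Set ℝ) =ᵐ[volume] Set.Ioi (θ * u) := by
    have := (Ioi_ae_eq_Ici (μ := volume) (a := θ * u)).symm.inter
      (Filter.EventuallyEq.refl (ae volume) (Set.Ioi (0 : ℝ)))
    rwa [Set.inter_eq_left.2 hsub] at this
  rw [Measure.restrict_congr_set hset, setLIntegral_congr_fun measurableSet_Ioi hdens,
    ← ofReal_integral_eq_lintegral_ofReal (integrableOn_Ioi_deriv_of_nonneg' hderiv hpos htend)
      ((ae_restrict_iff' measurableSet_Ioi).2 (.of_forall hpos)),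
    integral_Ioi_of_hasDerivAt_of_nonneg' hderiv hpos htend, inv_mul_cancel_left₀ hθ.ne']
  simp

end Erlang

/-! ### Derivatives of `exp (-κ s ^ (1 / α))` -/

section Hoppe

/-- The coefficient of `uˡ` in `e⁻ᵘ sⁿ (d/ds)ⁿ eᵘ`, where `u` is a multiple of `s ^ (1 / α)`. -/
noncomputable def hoppeCoeff (α : ℝ) (n l : ℕ) : ℝ :=
  ∑ m ∈ Finset.range (l + 1), (-1) ^ m * pochhammerSymbol (((l : ℝ) - m) / α + 1 - n) n /
    ((m.factorial : ℝ) * ((l - m).factorial : ℝ))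

lemma pochhammerSymbol_succ (x : ℝ) (n : ℕ) :
    pochhammerSymbol (x + 1 - (n + 1 : ℕ)) (n + 1) = (x - n) * pochhammerSymbol (x + 1 - n) n := by
  rw [pochhammerSymbol, pochhammerSymbol, ascPochhammer_succ_left]
  simp [sub_add_eq_add_sub]

lemma hoppeCoeff_succ_zero (α : ℝ) (n : ℕ) :
    hoppeCoeff α (n + 1) 0 = -n * hoppeCoeff α n 0 := by
  simp only [hoppeCoeff, pochhammerSymbol_succ]
  simp

/-- The recurrence that differentiation imposes on the coefficients, because `s u' = u / α`. -/
lemma hoppeCoeff_succ_succ (α : ℝ) (n l : ℕ) :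
    hoppeCoeff α (n + 1) (l + 1) =
      ((l + 1 : ℕ) / α - n) * hoppeCoeff α n (l + 1) + 1 / α * hoppeCoeff α n l := by
  have h : ∀ m ∈ Finset.range (l + 2),
      (-1) ^ m * pochhammerSymbol ((((l + 1 : ℕ) : ℝ) - m) / α + 1 - (n + 1 : ℕ)) (n + 1) /
        ((m.factorial : ℝ) * ((l + 1 - m).factorial : ℝ)) =
      ((l + 1 : ℕ) / α - n) * ((-1) ^ m * pochhammerSymbol ((((l + 1 : ℕ) : ℝ) - m) / α + 1 - n) n /
        ((m.factorial : ℝ) * ((l + 1 - m).factorial : ℝ))) -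
      1 / α * (m * ((-1) ^ m * pochhammerSymbol ((((l + 1 : ℕ) : ℝ) - m) / α + 1 - n) n /
        ((m.factorial : ℝ) * ((l + 1 - m).factorial : ℝ)))) := fun m _ => by
    rw [pochhammerSymbol_succ]; ring
  rw [hoppeCoeff, Finset.sum_congr rfl h, Finset.sum_sub_distrib, ← Finset.mul_sum,
    ← Finset.mul_sum, ← hoppeCoeff, sub_eq_add_neg, ← mul_neg]
  congr 2
  rw [Finset.sum_range_succ', hoppeCoeff]
  simp only [Nat.cast_zero, zero_mul, add_zero]
  rw [← Finset.sum_neg_distrib]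
  refine Finset.sum_congr rfl fun m _ => ?_
  rw [Nat.add_sub_add_right, Nat.factorial_succ, pow_succ]
  push_cast
  rw [add_sub_add_right_eq_sub]
  field_simp

/-- The coefficient is an `l`-th finite difference of a polynomial of degree `n`. -/
lemma hoppeCoeff_of_lt (α : ℝ) {n l : ℕ} (h : n < l) : hoppeCoeff α n l = 0 := by
  induction n generalizing l with
  | zero =>
    have h1 : ∀ m ∈ Finset.range (l + 1),
        (-1) ^ m * pochhammerSymbol (((l : ℝ) - m) / α + 1 - (0 : ℕ)) 0 /
          ((m.factorial : ℝ) * ((l - m).factorial : ℝ)) =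
        (l.factorial : ℝ)⁻¹ * ((-1 : ℝ) ^ m * 1 ^ (l - m) * l.choose m) := fun m hm => by
      rw [Nat.cast_choose ℝ (Nat.lt_succ_iff.1 (Finset.mem_range.1 hm))]
      have : (l.factorial : ℝ) ≠ 0 := by positivity
      simp only [pochhammerSymbol, ascPochhammer_zero, Polynomial.eval_one, one_pow]
      field_simp
    rw [hoppeCoeff, Finset.sum_congr rfl h1, ← Finset.mul_sum, ← add_pow]
    simp [h.ne']
  | succ n ih =>
    obtain ⟨l, rfl⟩ := Nat.exists_eq_succ_of_ne_zero (Nat.ne_zero_of_lt h)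
    rw [Nat.succ_eq_add_one, hoppeCoeff_succ_succ, ih (by omega), ih (by omega)]
    simp

lemma sum_hoppeCoeff_succ (α u : ℝ) (n : ℕ) :
    ∑ l ∈ Finset.range (n + 2), hoppeCoeff α (n + 1) l * u ^ l =
      ∑ l ∈ Finset.range (n + 1),
        hoppeCoeff α n l * (1 / α * u ^ (l + 1) + (l / α - n) * u ^ l) := by
  have h1 : ∑ l ∈ Finset.range (n + 1), hoppeCoeff α n l * ((l / α - n) * u ^ l) =
      ∑ l ∈ Finset.range (n + 2), hoppeCoeff α n l * ((l / α - n) * u ^ l) := by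
    rw [Finset.sum_range_succ _ (n + 1), hoppeCoeff_of_lt α (Nat.lt_succ_self n)]
    simp
  simp_rw [mul_add]
  rw [Finset.sum_add_distrib, h1, Finset.sum_range_succ', Finset.sum_range_succ' _ (n + 1),
    hoppeCoeff_succ_zero, ← add_assoc, ← Finset.sum_add_distrib]
  simp only [hoppeCoeff_succ_succ]
  congr 1
  · exact Finset.sum_congr rfl fun l _ => by ring
  · simp; ring

/-- Hoppe's form of the derivatives of `s ↦ exp (-κ s ^ (1 / α))`. -/
lemma iteratedDeriv_exp_neg_mul_rpow (κ α : ℝ) (n : ℕ) {s : ℝ} (hs : 0 < s) :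
    iteratedDeriv n (fun s : ℝ => Real.exp (-κ * s ^ (1 / α))) s =
      Real.exp (-κ * s ^ (1 / α)) * (s ^ n)⁻¹ *
        ∑ l ∈ Finset.range (n + 1), hoppeCoeff α n l * (-κ * s ^ (1 / α)) ^ l := by
  induction n generalizing s with
  | zero => simp [hoppeCoeff, pochhammerSymbol]
  | succ n ih =>
    have hev : iteratedDeriv n (fun s : ℝ => Real.exp (-κ * s ^ (1 / α))) =ᶠ[nhds s]
        fun s => Real.exp (-κ * s ^ (1 / α)) * (s ^ n)⁻¹ *
          ∑ l ∈ Finset.range (n + 1), hoppeCoeff α n l * (-κ * s ^ (1 / α)) ^ l := by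
      filter_upwards [lt_mem_nhds hs] with x hx using ih hx
    rw [iteratedDeriv_succ, hev.deriv_eq, sum_hoppeCoeff_succ]
    set u : ℝ := -κ * s ^ (1 / α) with hu
    have hderiv : HasDerivAt (fun s : ℝ => -κ * s ^ (1 / α)) (1 / α * u * s⁻¹) s := by
      refine ((Real.hasDerivAt_rpow_const (Or.inl hs.ne')).const_mul (-κ)).congr_deriv ?_
      rw [hu, Real.rpow_sub_one hs.ne']
      ring
    have hsum : HasDerivAt (fun s : ℝ => ∑ l ∈ Finset.range (n + 1),
        hoppeCoeff α n l * (-κ * s ^ (1 / α)) ^ l)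
        (∑ l ∈ Finset.range (n + 1), hoppeCoeff α n l * (l / α * u ^ l * s⁻¹)) s := by
      refine HasDerivAt.fun_sum fun l _ => ((hderiv.pow l).const_mul _).congr_deriv ?_
      rcases l with _ | l
      · simp
      · rw [← hu, Nat.add_sub_cancel]; ring
    have hpow : HasDerivAt (fun s : ℝ => (s ^ n)⁻¹) (-n * (s ^ n)⁻¹ * s⁻¹) s := by
      refine ((hasDerivAt_pow n s).inv (pow_ne_zero n hs.ne')).congr_deriv ?_
      rcases n with _ | n
      · simp
      · rw [Nat.add_sub_cancel]; field_simp; ring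
    rw [((hderiv.exp.fun_mul hpow).fun_mul hsum).deriv, ← hu]
    have hsum2 : ∑ l ∈ Finset.range (n + 1),
        hoppeCoeff α n l * (1 / α * u ^ (l + 1) + (l / α - n) * u ^ l) =
        (1 / α * u - n) * ∑ l ∈ Finset.range (n + 1), hoppeCoeff α n l * u ^ l +
        s * ∑ l ∈ Finset.range (n + 1), hoppeCoeff α n l * (l / α * u ^ l * s⁻¹) := by
      rw [Finset.mul_sum, Finset.mul_sum, ← Finset.sum_add_distrib]
      refine Finset.sum_congr rfl fun l _ => ?_
      field_simp
      ring
    rw [hsum2]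
    field_simp
    ring

end Hoppe

/-! ### Interference from one road -/

lemma lintegral_comp_add_abs (f : ℝ → ℝ≥0∞) (d : ℝ) :
    ∫⁻ y, f (d + |y|) = 2 * ∫⁻ r in Set.Ioi d, f r := by
  have h1 : ∫⁻ y in Set.Ioi 0, f (d + |y|) = ∫⁻ r in Set.Ioi d, f r := by
    rw [← (measurePreserving_add_left volume d).setLIntegral_comp_preimage_emb
      (measurableEmbedding_addLeft d) f (Set.Ioi d), Set.preimage_const_add_Ioi, sub_self]
    exact setLIntegral_congr_fun measurableSet_Ioi fun y (hy : 0 < y) => by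
      rw [abs_of_pos hy]
  have h2 : ∫⁻ y in Set.Iic 0, f (d + |y|) = ∫⁻ y in Set.Ioi 0, f (d + |y|) := by
    rw [setLIntegral_congr Iio_ae_eq_Iic.symm,
      ← (Measure.measurePreserving_neg (volume : Measure ℝ)).setLIntegral_comp_preimage_emb
      (MeasurableEquiv.neg ℝ).measurableEmbedding (fun y => f (d + |y|)) (Set.Iio 0)]
    simp
  rw [← lintegral_add_compl _ measurableSet_Iic, Set.compl_Iic, h2, h1, two_mul]

section Road

variable {Ω ι : Type*} {mΩ : MeasurableSpace Ω} {μ : Measure Ω}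

/-- If the points, the access decisions and the fadings of one road generate different members of
an independent family of σ-algebras, then access and fading of a vehicle are independent, the
pairs (access, fading) are independent, and all of them are independent of the points. -/
lemma indep_marks {I : Type*} {m : I → MeasurableSpace Ω} (hm : ∀ i, m i ≤ mΩ)
    (hind : iIndep m μ) {pt : I} {acc fad : ι → I} (hacc : acc.Injective) (hfad : fad.Injective)
    (haf : ∀ i j, acc i ≠ fad j) (hap : ∀ i, pt ≠ acc i) (hfp : ∀ i, pt ≠ fad i)
    {X : ι → Ω → ℝ} {T : ι → Ω → Bool} {S : ι → Ω → ℝ}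
    (hX : MeasurableSpace.comap (fun ω n => X n ω) inferInstance ≤ m pt)
    (hT : ∀ n, MeasurableSpace.comap (T n) inferInstance ≤ m (acc n))
    (hS : ∀ n, MeasurableSpace.comap (S n) inferInstance ≤ m (fad n)) :
    (∀ n, IndepFun (T n) (S n) μ) ∧ iIndepFun (fun n ω => (T n ω, S n ω)) μ ∧
      IndepFun (fun ω n => X n ω) (fun ω n => (T n ω, S n ω)) μ := by
  refine ⟨fun n => ?_, ?_, ?_⟩
  · exact indep_of_indep_of_le_left
      (indep_of_indep_of_le_right (hind.indep (haf n n)) (hS n)) (hT n)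
  · have h := iIndep_iSup_of_pairwise_disjoint hm hind (A := fun n => {acc n, fad n}) (by
      intro i j hij
      simp only [Set.disjoint_insert_left, Set.disjoint_singleton_left, Set.mem_insert_iff,
        Set.mem_singleton_iff, not_or]
      exact ⟨⟨fun h => hij (hacc h), haf i j⟩, fun h => haf j i h.symm, fun h => hij (hfad h)⟩)
    refine (iIndepFun_iff_iIndep _ _ μ).2 (iIndep_of_iIndep_of_le h fun n => ?_)
    rw [iSup_pair]
    exact (MeasurableSpace.comap_prodMk (T n) (S n)).trans_le (sup_le_sup (hT n) (hS n))
  · have h := indep_iSup_of_disjoint hm hind (S := {pt}) (T := Set.range acc ∪ Set.range fad) (by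
      rw [Set.disjoint_singleton_left]
      rintro (⟨n, hn⟩ | ⟨n, hn⟩)
      exacts [hap n hn.symm, hfp n hn.symm])
    rw [iSup_singleton] at h
    refine indep_of_indep_of_le_left (indep_of_indep_of_le_right h ?_) hX
    refine Measurable.comap_le (@measurable_pi_lambda _ _ _ (_) _ _ fun n => ?_)
    refine Measurable.prodMk ?_ ?_
    · exact measurable_iff_comap_le.2 ((hT n).trans
        (le_iSup₂_of_le (f := fun i _ => m i) (acc n) (Or.inl ⟨n, rfl⟩) le_rfl))
    · exact measurable_iff_comap_le.2 ((hS n).trans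
        (le_iSup₂_of_le (f := fun i _ => m i) (fad n) (Or.inr ⟨n, rfl⟩) le_rfl))

/-- The interference from the vehicles `X n` that transmit, with path gain `g` and fading `S n`. -/
noncomputable def alohaShotNoise (X : ι → Ω → ℝ) (T : ι → Ω → Bool) (S : ι → Ω → ℝ)
    (g : ℝ → ℝ≥0∞) (ω : Ω) : ℝ≥0∞ :=
  ∑' n, if T n ω = true then ENNReal.ofReal (S n ω) * g (X n ω) else 0

lemma measurable_alohaShotNoise [Countable ι] {X : ι → Ω → ℝ} {T : ι → Ω → Bool} {S : ι → Ω → ℝ}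
    (hX : ∀ n, Measurable (X n)) (hT : ∀ n, Measurable (T n)) (hS : ∀ n, Measurable (S n))
    {g : ℝ → ℝ≥0∞} (hg : Measurable g) : Measurable (alohaShotNoise X T S g) :=
  Measurable.tsum fun n => Measurable.ite (hT n (measurableSet_singleton true))
    ((hS n).ennreal_ofReal.mul (hg.comp (hX n))) measurable_const

lemma receivedInterference_eq_mul_alohaShotNoise {P : ℝ} (hP : 0 ≤ P)
    (loss : ℝ × ℝ → ℝ × ℝ → ℝ≥0∞) (e : ℝ → ℝ × ℝ) (X : ι → Ω → ℝ) (T : ι → Ω → Bool)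
    (S : ι → Ω → ℝ) (rx : ℝ × ℝ) (ω : Ω) :
    receivedInterference P loss (fun n ω => e (X n ω)) T S rx ω =
      ENNReal.ofReal P * alohaShotNoise X T S (fun x => loss (e x) rx) ω := by
  rw [receivedInterference, alohaShotNoise, ← ENNReal.tsum_mul_left]
  refine tsum_congr fun n => ?_
  split_ifs
  · rw [ENNReal.ofReal_mul hP, mul_assoc]
  · simp

/-- The Laplace transform of the interference when the path gain is `A (d + |y|)⁻ᵅ` up to a
measure preserving change `e` of the position and up to a null set, and the fading is Erlang. -/
lemma IsPoissonPointProcess.laplace_alohaShotNoise [Countable ι] [IsProbabilityMeasure μ]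
    {X : ι → Ω → ℝ} {lam p : ℝ}
    (hX : IsPoissonPointProcess X lam μ) (hlam : 0 ≤ lam) (hp0 : 0 ≤ p) (hp1 : p ≤ 1)
    {T : ι → Ω → Bool} {S : ι → Ω → ℝ} {k : ℕ} {θ : ℝ} (hk : 1 ≤ k) (hθ : 0 < θ)
    (hTm : ∀ n, Measurable (T n)) (hSm : ∀ n, Measurable (S n))
    (hT : ∀ n, μ {ω | T n ω = true} = ENNReal.ofReal p) (hS : ∀ n, HasLaw (S n) (erlangLaw k θ) μ)
    (hind : (∀ n, IndepFun (T n) (S n) μ) ∧ iIndepFun (fun n ω => (T n ω, S n ω)) μ ∧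
      IndepFun (fun ω n => X n ω) (fun ω n => (T n ω, S n ω)) μ)
    {g : ℝ → ℝ≥0∞} (hgm : Measurable g) {A α d : ℝ} (hA : 0 < A) (hα : 1 < α) (hd : 0 ≤ d)
    {e : ℝ → ℝ} (he : MeasurePreserving e volume volume)
    (hg : ∀ y, e y ≠ 0 → g y = ENNReal.ofReal (A * (d + |e y|) ^ (-α))) {s : ℝ} (hs : 0 < s) :
    ∫⁻ ω, negExp (ENNReal.ofReal s * alohaShotNoise X T S g ω) ∂μ =
      ENNReal.ofReal (Real.exp (-(2 * p * lam * halfLineExponent k α d (A * s * θ)))) := by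
  have := isProbabilityMeasure_erlangLaw hk hθ
  have hc : 0 < A * s * θ := by positivity
  have h1 : ∀ ω, ENNReal.ofReal s * alohaShotNoise X T S g ω =
      ∑' n, if T n ω = true then ENNReal.ofReal (S n ω) * (ENNReal.ofReal s * g (X n ω)) else 0 :=
    fun ω => by
      rw [alohaShotNoise, ← ENNReal.tsum_mul_left]
      refine tsum_congr fun n => ?_
      split_ifs
      · ring
      · simp
  simp_rw [h1]
  rw [hX.laplace_aloha hlam hp0 hp1 hTm hSm hT hS hind.1 hind.2.1 hind.2.2
    (g := fun y => ENNReal.ofReal s * g y) (by fun_prop)]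
  have h2 : ∀ᵐ y, (1 - ∫⁻ x, negExp (ENNReal.ofReal x * (ENNReal.ofReal s * g y))
        ∂(erlangLaw k θ)) =
      ENNReal.ofReal (1 - ((1 + A * s * θ * (d + |e y|) ^ (-α)) ^ k)⁻¹) := by
    have h0 : ∀ᵐ y : ℝ, y ≠ 0 := by
      simpa using measure_eq_zero_iff_ae_notMem.1 (measure_singleton (μ := volume) (0 : ℝ))
    filter_upwards [he.quasiMeasurePreserving.ae h0] with y hy
    have hr : 0 ≤ (d + |e y|) ^ (-α) := Real.rpow_nonneg (by positivity) _
    have hpos : 0 ≤ ((1 + A * s * θ * (d + |e y|) ^ (-α)) ^ k)⁻¹ := by positivity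
    rw [hg y hy, ← ENNReal.ofReal_mul hs.le, lintegral_negExp_erlangLaw hk hθ (by positivity),
      ENNReal.ofReal_sub _ hpos, ENNReal.ofReal_one,
      show θ * (s * (A * (d + |e y|) ^ (-α))) = A * s * θ * (d + |e y|) ^ (-α) by ring]
  rw [lintegral_congr_ae h2, he.lintegral_comp (f := fun y =>
    ENNReal.ofReal (1 - ((1 + A * s * θ * (d + |y|) ^ (-α)) ^ k)⁻¹)) (by fun_prop),
    lintegral_comp_add_abs (f := fun y =>
      ENNReal.ofReal (1 - ((1 + A * s * θ * y ^ (-α)) ^ k)⁻¹)) d,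
    lintegral_one_sub_inv_pow k hα hc hd, ← negExp_ofReal]
  · congr 1
    rw [show (2 : ℝ≥0∞) = ENNReal.ofReal 2 by simp, ← ENNReal.ofReal_mul zero_le_two,
      ← ENNReal.ofReal_mul (by positivity)]
    congr 1; ring
  · have := halfLineExponent_nonneg k hα hc hd
    positivity

end Road

/-! ### Moments and derivatives of Laplace transforms -/

section LaplaceTransform

variable {Ω : Type*} [MeasurableSpace Ω] {μ : Measure Ω}

/-- A `[0, ∞]`-valued variable whose Laplace transform tends to `1` at `0` is almost surely
finite, because `e⁻ˢᴵ` vanishes where `I = ∞`. -/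
lemma ae_ne_top_of_laplace [IsProbabilityMeasure μ] {I : Ω → ℝ≥0∞} (hI : Measurable I) {L : ℝ → ℝ}
    (hL : ∀ s, 0 < s → ∫⁻ ω, negExp (ENNReal.ofReal s * I ω) ∂μ = ENNReal.ofReal (L s))
    (hlim : Filter.Tendsto L (nhdsWithin 0 (Set.Ioi 0)) (nhds 1)) : ∀ᵐ ω ∂μ, I ω ≠ ⊤ := by
  have hset : MeasurableSet {ω | I ω ≠ ⊤} := (hI (measurableSet_singleton ⊤)).compl
  have hle : ∀ s, 0 < s → ENNReal.ofReal (L s) ≤ μ {ω | I ω ≠ ⊤} := fun s hs => by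
    rw [← hL s hs, ← lintegral_indicator_one hset]
    refine lintegral_mono fun ω => ?_
    by_cases h : I ω = ⊤
    · simp [h, ENNReal.mul_top, hs]
    · rw [Set.indicator_of_mem (by exact h)]
      exact negExp_le_one _
  have h1 : 1 ≤ μ {ω | I ω ≠ ⊤} := by
    have := (ENNReal.continuous_ofReal.tendsto 1).comp hlim
    rw [ENNReal.ofReal_one] at this
    exact le_of_tendsto this (by
      filter_upwards [self_mem_nhdsWithin] with s hs using hle s hs)
  exact (mem_ae_iff_prob_eq_one hset).2 (le_antisymm prob_le_one h1)

lemma integral_exp_neg_mul_toReal {I : Ω → ℝ≥0∞} (hI : Measurable I) (hfin : ∀ᵐ ω ∂μ, I ω ≠ ⊤)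
    {s l : ℝ} (hs : 0 < s) (hl : 0 ≤ l)
    (hL : ∫⁻ ω, negExp (ENNReal.ofReal s * I ω) ∂μ = ENNReal.ofReal l) :
    ∫ ω, Real.exp (-s * (I ω).toReal) ∂μ = l := by
  rw [integral_eq_lintegral_of_nonneg_ae (.of_forall fun _ => (Real.exp_pos _).le)
    (Measurable.aestronglyMeasurable (by fun_prop)), ← ENNReal.toReal_ofReal hl, ← hL]
  congr 1
  refine lintegral_congr_ae ?_
  filter_upwards [hfin] with ω hω
  rw [negExp_of_ne_top (ENNReal.mul_ne_top ENNReal.ofReal_ne_top hω), ENNReal.toReal_mul,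
    ENNReal.toReal_ofReal hs.le, neg_mul]

variable {Y : Ω → ℝ} {L : ℝ → ℝ}

lemma Ioi_subset_interior_integrableExpSet_neg [IsProbabilityMeasure μ] (hY : Measurable Y)
    (hY0 : ∀ ω, 0 ≤ Y ω) :
    Set.Ioi 0 ⊆ interior (integrableExpSet (fun ω => -Y ω) μ) := by
  refine interior_maximal (fun s hs => ?_) isOpen_Ioi
  have hs : 0 < s := hs
  refine Integrable.of_bound (Measurable.aestronglyMeasurable (by fun_prop)) 1
    (.of_forall fun ω => ?_)
  rw [Real.norm_of_nonneg (Real.exp_pos _).le, Real.exp_le_one_iff]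
  nlinarith [hY0 ω]

lemma eqOn_mgf_neg (hL : ∀ s, 0 < s → ∫ ω, Real.exp (-s * Y ω) ∂μ = L s) :
    Set.EqOn L (mgf (fun ω => -Y ω) μ) (Set.Ioi 0) := fun s hs => by
  rw [← hL s hs, mgf]
  simp

lemma contDiffOn_laplace [IsProbabilityMeasure μ] (hY : Measurable Y) (hY0 : ∀ ω, 0 ≤ Y ω)
    (hL : ∀ s, 0 < s → ∫ ω, Real.exp (-s * Y ω) ∂μ = L s) :
    ContDiffOn ℝ (⊤ : ℕ∞) L (Set.Ioi 0) :=
  ((analyticOnNhd_mgf.mono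
    (Ioi_subset_interior_integrableExpSet_neg hY hY0)).contDiffOn
      (uniqueDiffOn_Ioi 0)).congr (eqOn_mgf_neg hL)

lemma integrable_pow_mul_exp_neg [IsProbabilityMeasure μ] (hY : Measurable Y)
    (hY0 : ∀ ω, 0 ≤ Y ω) {s : ℝ} (hs : 0 < s) (n : ℕ) :
    Integrable (fun ω => Y ω ^ n * Real.exp (-s * Y ω)) μ := by
  have := (integrable_pow_mul_exp_of_mem_interior_integrableExpSet
    (Ioi_subset_interior_integrableExpSet_neg (μ := μ) hY hY0 hs) n).const_mul ((-1) ^ n)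
  refine this.congr (.of_forall fun ω => ?_)
  beta_reduce
  rw [← mul_assoc, ← mul_pow]
  simp

lemma iteratedDeriv_laplace [IsProbabilityMeasure μ] (hY : Measurable Y) (hY0 : ∀ ω, 0 ≤ Y ω)
    (hL : ∀ s, 0 < s → ∫ ω, Real.exp (-s * Y ω) ∂μ = L s) {s : ℝ} (hs : 0 < s) (n : ℕ) :
    (-1) ^ n * iteratedDeriv n L s = ∫ ω, Y ω ^ n * Real.exp (-s * Y ω) ∂μ := by
  rw [Filter.EventuallyEq.iteratedDeriv_eq n
      ((eqOn_mgf_neg hL).eventuallyEq_of_mem (Ioi_mem_nhds hs)),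
    iteratedDeriv_mgf (Ioi_subset_interior_integrableExpSet_neg hY hY0 hs), ← integral_const_mul]
  refine integral_congr_ae (.of_forall fun ω => ?_)
  beta_reduce
  rw [← mul_assoc, ← mul_pow]
  simp

lemma tendsto_exp_neg_halfLineExponent {k : ℕ} {α d a : ℝ} (hα : 1 < α) (hd : 0 ≤ d) (ha : 0 < a)
    (b : ℝ) :
    Filter.Tendsto (fun s => Real.exp (-(b * halfLineExponent k α d (a * s))))
      (nhdsWithin 0 (Set.Ioi 0)) (nhds 1) := by
  have hα0 : 0 < 1 / α := by positivity
  have h1 : Filter.Tendsto (fun s : ℝ => (a * s) ^ (1 / α) * halfLineExponent k α 0 1)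
      (nhdsWithin 0 (Set.Ioi 0)) (nhds 0) := by
    have h2 : Continuous fun s : ℝ => (a * s) ^ (1 / α) * halfLineExponent k α 0 1 :=
      ((continuous_const.mul continuous_id).rpow_const fun _ => Or.inr hα0.le).mul_const _
    have h3 := h2.tendsto 0
    rw [mul_zero, Real.zero_rpow hα0.ne', zero_mul] at h3
    exact h3.mono_left nhdsWithin_le_nhds
  have h2 : Filter.Tendsto (fun s : ℝ => halfLineExponent k α d (a * s))
      (nhdsWithin 0 (Set.Ioi 0)) (nhds 0) := by
    refine tendsto_of_tendsto_of_tendsto_of_le_of_le' tendsto_const_nhds h1 ?_ ?_ <;>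
    filter_upwards [self_mem_nhdsWithin] with s (hs : 0 < s)
    · exact halfLineExponent_nonneg k hα (by positivity) hd
    · rw [← halfLineExponent_zero hα (by positivity)]
      exact halfLineExponent_le k hα (by positivity) hd
  have h3 := (Real.continuous_exp.tendsto _).comp (h2.const_mul b).neg
  rwa [mul_zero, neg_zero, Real.exp_zero] at h3

end LaplaceTransform

/-! ### The reception probability given the Laplace transforms -/

section Reception

variable {Ω : Type*} [MeasurableSpace Ω] {μ : Measure Ω} [IsProbabilityMeasure μ]

/-- Averaging the Erlang tail over an independent threshold. -/
lemma measureReal_mul_le_erlang {k : ℕ} {θ : ℝ} (hk : 1 ≤ k) (hθ : 0 < θ) {W S : Ω → ℝ}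
    (hW : Measurable W) (hW0 : ∀ ω, 0 ≤ W ω) (hSm : Measurable S) (hS : HasLaw S (erlangLaw k θ) μ)
    (hind : IndepFun W S μ) :
    μ.real {ω | θ * W ω ≤ S ω} =
      ∫ ω, Real.exp (-W ω) * ∑ i ∈ Finset.range k, W ω ^ i / i.factorial ∂μ := by
  have := isProbabilityMeasure_erlangLaw hk hθ
  have hset : MeasurableSet {q : ℝ × ℝ | θ * q.1 ≤ q.2} :=
    measurableSet_le (by fun_prop) (by fun_prop)
  rw [integral_eq_lintegral_of_nonneg_ae, Measure.real]
  · congr 1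
    change μ ((fun ω => (W ω, S ω)) ⁻¹' {q : ℝ × ℝ | θ * q.1 ≤ q.2}) = _
    rw [← Measure.map_apply (hW.prodMk hSm) hset,
      (indepFun_iff_map_prod_eq_prod_map_map hW.aemeasurable hSm.aemeasurable).1 hind,
      hS.map_eq, Measure.prod_apply hset, lintegral_map (measurable_measure_prodMk_left hset) hW]
    exact lintegral_congr fun ω => erlangLaw_Ici hk hθ (hW0 ω)
  · exact .of_forall fun ω => mul_nonneg (Real.exp_pos _).le
      (Finset.sum_nonneg fun i _ => div_nonneg (pow_nonneg (hW0 ω) i) (Nat.cast_nonneg _))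
  · exact Measurable.aestronglyMeasurable (by fun_prop)

/-- Expansion of the averaged Erlang tail by the binomial theorem, the two interferences being
independent. -/
lemma integral_erlang_tail {H V : Ω → ℝ} (hH : Measurable H) (hV : Measurable V)
    (hH0 : ∀ ω, 0 ≤ H ω) (hV0 : ∀ ω, 0 ≤ V ω) (hind : IndepFun H V μ) {ζ : ℝ} (hζ : 0 < ζ)
    (η : ℝ) (k : ℕ) :
    ∫ ω, Real.exp (-(ζ * (H ω + V ω + η))) *
        ∑ i ∈ Finset.range k, (ζ * (H ω + V ω + η)) ^ i / i.factorial ∂μ =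
      Real.exp (-(ζ * η)) * ∑ i ∈ Finset.range k, ∑ j ∈ Finset.range (i + 1),
        (i.choose j : ℝ) * (ζ ^ i / i.factorial) *
          (∑ n ∈ Finset.range (j + 1), (j.choose n : ℝ) * η ^ (j - n) *
            ∫ ω, H ω ^ n * Real.exp (-ζ * H ω) ∂μ) *
          ∫ ω, V ω ^ (i - j) * Real.exp (-ζ * V ω) ∂μ := by
  have hHint := fun n => integrable_pow_mul_exp_neg (μ := μ) hH hH0 hζ n
  have hVint := fun n => integrable_pow_mul_exp_neg (μ := μ) hV hV0 hζ n
  have hindc : ∀ m n : ℕ, IndepFun (fun ω => H ω ^ n * Real.exp (-ζ * H ω))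
      (fun ω => V ω ^ m * Real.exp (-ζ * V ω)) μ := fun m n =>
    hind.comp (φ := fun x => x ^ n * Real.exp (-ζ * x)) (ψ := fun x => x ^ m * Real.exp (-ζ * x))
      (by fun_prop) (by fun_prop)
  have hint : ∀ m n : ℕ, Integrable (fun ω => (H ω ^ n * Real.exp (-ζ * H ω)) *
      (V ω ^ m * Real.exp (-ζ * V ω))) μ := fun m n =>
    (hindc m n).integrable_mul (hHint n) (hVint m)
  have hprod : ∀ m n : ℕ, ∫ ω, (H ω ^ n * Real.exp (-ζ * H ω)) *
      (V ω ^ m * Real.exp (-ζ * V ω)) ∂μ = (∫ ω, H ω ^ n * Real.exp (-ζ * H ω) ∂μ) *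
        ∫ ω, V ω ^ m * Real.exp (-ζ * V ω) ∂μ := fun m n =>
    (hindc m n).integral_fun_mul_eq_mul_integral (hHint n).1 (hVint m).1
  have hpt : ∀ ω, Real.exp (-(ζ * (H ω + V ω + η))) *
      ∑ i ∈ Finset.range k, (ζ * (H ω + V ω + η)) ^ i / i.factorial =
      ∑ i ∈ Finset.range k, ∑ j ∈ Finset.range (i + 1), ∑ n ∈ Finset.range (j + 1),
        (Real.exp (-(ζ * η)) * ((i.choose j : ℝ) * (ζ ^ i / i.factorial)) *
          ((j.choose n : ℝ) * η ^ (j - n))) *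
        ((H ω ^ n * Real.exp (-ζ * H ω)) * (V ω ^ (i - j) * Real.exp (-ζ * V ω))) := fun ω => by
    rw [Finset.mul_sum]
    refine Finset.sum_congr rfl fun i _ => ?_
    rw [show -(ζ * (H ω + V ω + η)) = -(ζ * η) + -ζ * H ω + -ζ * V ω by ring, Real.exp_add,
      Real.exp_add, mul_pow, show H ω + V ω + η = (H ω + η) + V ω by ring, add_pow, Finset.mul_sum,
      Finset.sum_div, Finset.mul_sum]
    refine Finset.sum_congr rfl fun j _ => ?_
    rw [add_pow, Finset.sum_mul, Finset.sum_mul, Finset.mul_sum, Finset.sum_div, Finset.mul_sum]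
    exact Finset.sum_congr rfl fun n _ => by ring
  simp_rw [hpt]
  rw [integral_finsetSum _ fun i _ => integrable_finsetSum _ fun j _ =>
    integrable_finsetSum _ fun n _ => (hint _ _).const_mul _, Finset.mul_sum]
  refine Finset.sum_congr rfl fun i _ => ?_
  rw [integral_finsetSum _ fun j _ => integrable_finsetSum _ fun n _ => (hint _ _).const_mul _,
    Finset.mul_sum]
  refine Finset.sum_congr rfl fun j _ => ?_
  rw [integral_finsetSum _ fun n _ => (hint _ _).const_mul _, Finset.mul_sum, Finset.sum_mul,
    Finset.mul_sum]
  refine Finset.sum_congr rfl fun n _ => ?_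
  rw [integral_const_mul, hprod]
  ring

/-- `C⁽ʲ⁾` collects the derivatives of the Laplace transform `exp (-κ s ^ (1 / α))`. -/
lemma coeffC_eq_sum_iteratedDeriv (κ α η : ℝ) {ζ : ℝ} (hζ : 0 < ζ) (j : ℕ) :
    coeffC κ α η ζ j = ∑ n ∈ Finset.range (j + 1), (j.choose n : ℝ) * η ^ (j - n) *
      ((-1) ^ n * iteratedDeriv n (fun s : ℝ => Real.exp (-κ * s ^ (1 / α))) ζ) := by
  refine Finset.sum_congr rfl fun n _ => ?_
  rw [iteratedDeriv_exp_neg_mul_rpow κ α n hζ]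
  have : ∑ l ∈ Finset.range (n + 1), hoppeCoeff α n l * (-κ * ζ ^ (1 / α)) ^ l =
      ∑ l ∈ Finset.range (n + 1), ∑ m ∈ Finset.range (l + 1),
        (-1) ^ m * (-κ * ζ ^ (1 / α)) ^ l * pochhammerSymbol (((l : ℝ) - m) / α + 1 - n) n /
          ((m.factorial : ℝ) * ((l - m).factorial : ℝ)) :=
    Finset.sum_congr rfl fun l _ => by
      rw [hoppeCoeff, Finset.sum_mul]
      exact Finset.sum_congr rfl fun m _ => by ring
  rw [this]
  ring

/-- Positivity of the numerator `a` makes this true for `b = 0` as well, where the quotient is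
`∞`. -/
lemma ofReal_le_ofReal_div_ofReal_iff {β a b : ℝ} (hβ : 0 ≤ β) (ha : 0 < a) :
    ENNReal.ofReal β ≤ ENNReal.ofReal a / ENNReal.ofReal b ↔ β * b ≤ a := by
  rw [ENNReal.le_div_iff_mul_le (Or.inr (by simpa using ha)) (Or.inl ENNReal.ofReal_ne_top),
    ← ENNReal.ofReal_mul hβ, ENNReal.ofReal_le_ofReal_iff ha.le]

end Reception

/-! ### The intersection -/

section Intersection

lemma measurable_manhattanLoss (A α d : ℝ) :
    Measurable fun y : ℝ => manhattanLoss A α (0, y) (d, 0) := by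
  unfold manhattanLoss
  fun_prop

lemma measurable_euclideanLoss (A α d : ℝ) :
    Measurable fun x : ℝ => euclideanLoss A α (x, 0) (d, 0) := by
  unfold euclideanLoss
  fun_prop

lemma manhattanLoss_eq_ofReal {A : ℝ} (hA : 0 ≤ A) (α : ℝ) {x y : ℝ × ℝ}
    (h : 0 < |y.1 - x.1| + |y.2 - x.2|) :
    manhattanLoss A α x y = ENNReal.ofReal (A * (|y.1 - x.1| + |y.2 - x.2|) ^ (-α)) := by
  rw [manhattanLoss, ENNReal.ofReal_rpow_of_pos h, ← ENNReal.ofReal_mul hA]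

lemma euclideanLoss_eq_ofReal {A : ℝ} (hA : 0 ≤ A) (α : ℝ) {x d : ℝ} (h : d - x ≠ 0) :
    euclideanLoss A α (x, 0) (d, 0) = ENNReal.ofReal (A * |d - x| ^ (-α)) := by
  have : √((d - x) ^ 2 + (0 - 0) ^ 2) = |d - x| := by simp [Real.sqrt_sq_eq_abs]
  rw [euclideanLoss]
  simp only [this]
  rw [ENNReal.ofReal_rpow_of_pos (abs_pos.2 h), ← ENNReal.ofReal_mul hA]

lemma crossRoadLaplace_eq_exp_halfLineExponent (p lamV : ℝ) (k : ℕ) (θ A α d s : ℝ) :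
    crossRoadLaplace p lamV k θ A α d s =
      Real.exp (-(2 * p * lamV * halfLineExponent k α d (A * s * θ))) := by
  rw [crossRoadLaplace, halfLineExponent]
  congr 1
  ring

lemma exp_neg_kappaH_mul_rpow {p lamH A α s : ℝ} (hA : 0 < A) (hα : 1 < α) (hs : 0 < s) :
    Real.exp (-(2 * p * lamH * halfLineExponent 1 α 0 (A * s * 1))) =
      Real.exp (-kappaH p lamH A α * s ^ (1 / α)) := by
  rw [halfLineExponent_zero hα (by positivity), halfLineExponent_one_zero hα, kappaH, mul_one,
    Real.mul_rpow hA.le hs.le]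
  congr 1
  ring

variable {Ω ιH ιV : Type*} {XH : ιH → Ω → ℝ} {TH : ιH → Ω → Bool} {SH : ιH → Ω → ℝ}
  {XV : ιV → Ω → ℝ} {TV : ιV → Ω → Bool} {SV : ιV → Ω → ℝ} {S0 : Ω → ℝ}

/-- For finite interferences, the reception condition bounds the useful fading from below by a
multiple of the total interference. -/
lemma ofReal_le_sinr_iff {P N β θ A α : ℝ} (hP : 0 < P) (hN : 0 ≤ N) (hβ : 0 < β) (hθ : 0 < θ)
    (hA : 0 < A) {lossH lossV : ℝ × ℝ → ℝ × ℝ → ℝ≥0∞} {tx rx : ℝ × ℝ}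
    (htx : 0 < |rx.1 - tx.1| + |rx.2 - tx.2|) {ω : Ω} (hS : 0 < S0 ω)
    (hH : alohaShotNoise XH TH SH (fun x => lossH (x, 0) rx) ω ≠ ⊤)
    (hV : alohaShotNoise XV TV SV (fun y => lossV (0, y) rx) ω ≠ ⊤) :
    ENNReal.ofReal β ≤ sinr P N (manhattanLoss A α) lossH lossV XH TH SH XV TV SV S0 tx rx ω ↔
      θ * (β * (|rx.1 - tx.1| + |rx.2 - tx.2|) ^ α / (A * θ) *
        ((alohaShotNoise XH TH SH (fun x => lossH (x, 0) rx) ω).toReal +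
          (alohaShotNoise XV TV SV (fun y => lossV (0, y) rx) ω).toReal + N / P)) ≤ S0 ω := by
  rw [sinr, receivedInterference_eq_mul_alohaShotNoise hP.le lossH (fun x => (x, 0)),
    receivedInterference_eq_mul_alohaShotNoise hP.le lossV (fun y => (0, y)),
    manhattanLoss_eq_ofReal hA.le α htx, ← ENNReal.ofReal_mul (by positivity)]
  lift alohaShotNoise XH TH SH (fun x => lossH (x, 0) rx) ω to ℝ≥0 using hH with x
  lift alohaShotNoise XV TV SV (fun y => lossV (0, y) rx) ω to ℝ≥0 using hV with y
  set r := |rx.1 - tx.1| + |rx.2 - tx.2| with hr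
  have hrα : 0 < r ^ α := Real.rpow_pos_of_pos htx α
  rw [← ENNReal.ofReal_coe_nnreal, ← ENNReal.ofReal_coe_nnreal, ← ENNReal.ofReal_mul hP.le,
    ← ENNReal.ofReal_mul hP.le, ← ENNReal.ofReal_add (by positivity) (by positivity),
    ← ENNReal.ofReal_add (by positivity) hN, ofReal_le_ofReal_div_ofReal_iff hβ.le (by positivity),
    ENNReal.toReal_ofReal x.coe_nonneg, ENNReal.toReal_ofReal y.coe_nonneg, Real.rpow_neg htx.le]
  have h1 : θ * (β * r ^ α / (A * θ) * (x + y + N / P)) =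
      β * (P * x + P * y + N) * (r ^ α / (P * A)) := by
    field_simp
  have h2 : P * S0 ω * (A * (r ^ α)⁻¹) = S0 ω / (r ^ α / (P * A)) := by
    field_simp
  rw [h1, h2, le_div_iff₀ (by positivity)]

lemma measurable_iSup_of_mem {I : Type*} {m : I → MeasurableSpace Ω} {s : Set I} {i : I}
    (hi : i ∈ s) {β : Type*} {mβ : MeasurableSpace β} {f : Ω → β} (hf : Measurable[m i] f) :
    Measurable[⨆ i ∈ s, m i] f :=
  hf.mono (le_iSup₂_of_le (f := fun i _ => m i) i hi le_rfl) le_rfl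

/-- The sources of randomness behind the interference from the horizontal road. -/
def RandomSource.horizontal (ιH ιV : Type*) : Set (RandomSource ιH ιV) :=
  {.pointsH} ∪ Set.range .accessH ∪ Set.range .fadingH

/-- The sources of randomness behind the interference from the vertical road. -/
def RandomSource.vertical (ιH ιV : Type*) : Set (RandomSource ιH ιV) :=
  {.pointsV} ∪ Set.range .accessV ∪ Set.range .fadingV

lemma measurable_sigma_horizontal [Countable ιH] {g : ℝ → ℝ≥0∞} (hg : Measurable g) :
    Measurable[⨆ i ∈ RandomSource.horizontal ιH ιV, RandomSource.sigma XH TH SH XV TV SV S0 i]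
      (alohaShotNoise XH TH SH g) := by
  refine @measurable_alohaShotNoise _ _ (_) _ _ _ _ (fun n => ?_) (fun n => ?_) (fun n => ?_) _ hg
  · refine measurable_iSup_of_mem (i := .pointsH) (by simp [RandomSource.horizontal]) ?_
    exact (measurable_pi_apply n).comp (comap_measurable fun ω n => XH n ω)
  · refine measurable_iSup_of_mem (i := .accessH n) (by simp [RandomSource.horizontal]) ?_
    exact comap_measurable (TH n)
  · refine measurable_iSup_of_mem (i := .fadingH n) (by simp [RandomSource.horizontal]) ?_
    exact comap_measurable (SH n)

lemma measurable_sigma_vertical [Countable ιV] {g : ℝ → ℝ≥0∞} (hg : Measurable g) :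
    Measurable[⨆ i ∈ RandomSource.vertical ιH ιV, RandomSource.sigma XH TH SH XV TV SV S0 i]
      (alohaShotNoise XV TV SV g) := by
  refine @measurable_alohaShotNoise _ _ (_) _ _ _ _ (fun n => ?_) (fun n => ?_) (fun n => ?_) _ hg
  · refine measurable_iSup_of_mem (i := .pointsV) (by simp [RandomSource.vertical]) ?_
    exact (measurable_pi_apply n).comp (comap_measurable fun ω n => XV n ω)
  · refine measurable_iSup_of_mem (i := .accessV n) (by simp [RandomSource.vertical]) ?_
    exact comap_measurable (TV n)
  · refine measurable_iSup_of_mem (i := .fadingV n) (by simp [RandomSource.vertical]) ?_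
    exact comap_measurable (SV n)

variable [mΩ : MeasurableSpace Ω] {μ : Measure Ω} {lamH lamV p : ℝ} {νH νV ν0 : Measure ℝ}

lemma IsAlohaIntersection.sigma_le
    (h : IsAlohaIntersection μ lamH lamV p νH νV ν0 XH TH SH XV TV SV S0)
    (i : RandomSource ιH ιV) : RandomSource.sigma XH TH SH XV TV SV S0 i ≤ mΩ := by
  cases i with
  | usefulFading => exact h.measurable_usefulFading.comap_le
  | pointsH => exact (measurable_pi_lambda _ h.pointsH.measurable_point).comap_le
  | pointsV => exact (measurable_pi_lambda _ h.pointsV.measurable_point).comap_le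
  | accessH n => exact (h.measurable_accessH n).comap_le
  | accessV n => exact (h.measurable_accessV n).comap_le
  | fadingH n => exact (h.measurable_fadingH n).comap_le
  | fadingV n => exact (h.measurable_fadingV n).comap_le

lemma IsAlohaIntersection.indepFun_interference [Countable ιH] [Countable ιV]
    (h : IsAlohaIntersection μ lamH lamV p νH νV ν0 XH TH SH XV TV SV S0)
    {g g' : ℝ → ℝ≥0∞} (hg : Measurable g) (hg' : Measurable g') :
    IndepFun (alohaShotNoise XH TH SH g) (alohaShotNoise XV TV SV g') μ := by
  have hi := indep_iSup_of_disjoint h.sigma_le h.indep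
    (S := RandomSource.horizontal ιH ιV) (T := RandomSource.vertical ιH ιV) (by
      rw [Set.disjoint_left]
      rintro i ((rfl | ⟨n, rfl⟩) | ⟨n, rfl⟩) <;> simp [RandomSource.vertical])
  exact indep_of_indep_of_le_left (indep_of_indep_of_le_right hi
    (measurable_sigma_vertical hg').comap_le) (measurable_sigma_horizontal hg).comap_le

lemma IsAlohaIntersection.indepFun_interference_usefulFading [Countable ιH] [Countable ιV]
    (h : IsAlohaIntersection μ lamH lamV p νH νV ν0 XH TH SH XV TV SV S0)
    {g g' : ℝ → ℝ≥0∞} (hg : Measurable g) (hg' : Measurable g') :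
    IndepFun (fun ω => (alohaShotNoise XH TH SH g ω, alohaShotNoise XV TV SV g' ω)) S0 μ := by
  have hi := indep_iSup_of_disjoint h.sigma_le h.indep
    (S := RandomSource.horizontal ιH ιV ∪ RandomSource.vertical ιH ιV)
    (T := {RandomSource.usefulFading}) (by
      simp [RandomSource.vertical, RandomSource.horizontal])
  rw [iSup_singleton, iSup_union] at hi
  refine indep_of_indep_of_le_left hi ?_
  exact (MeasurableSpace.comap_prodMk _ _).trans_le (sup_le_sup
    (measurable_sigma_horizontal hg).comap_le (measurable_sigma_vertical hg').comap_le)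

lemma IsAlohaIntersection.laplace_horizontal [Countable ιH] [IsProbabilityMeasure μ]
    (h : IsAlohaIntersection μ lamH lamV p (erlangLaw 1 1) νV ν0 XH TH SH XV TV SV S0)
    (hlamH : 0 ≤ lamH) (hp0 : 0 ≤ p) (hp1 : p ≤ 1) {A α : ℝ} (hA : 0 < A) (hα : 1 < α) (d : ℝ)
    {s : ℝ} (hs : 0 < s) :
    ∫⁻ ω, negExp (ENNReal.ofReal s *
        alohaShotNoise XH TH SH (fun x => euclideanLoss A α (x, 0) (d, 0)) ω) ∂μ =
      ENNReal.ofReal (Real.exp (-kappaH p lamH A α * s ^ (1 / α))) := by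
  rw [← exp_neg_kappaH_mul_rpow hA hα hs]
  refine h.pointsH.laplace_alohaShotNoise hlamH hp0 hp1 le_rfl one_pos h.measurable_accessH
    h.measurable_fadingH h.accessH h.fadingH (indep_marks h.sigma_le h.indep (pt := .pointsH)
      (acc := .accessH) (fad := .fadingH) (fun _ _ => by simp) (fun _ _ => by simp) (by simp)
      (by simp) (by simp) le_rfl (fun _ => le_rfl) (fun _ => le_rfl))
    (measurable_euclideanLoss A α d) hA hα le_rfl (Measure.measurePreserving_sub_left volume d)
    (fun x hx => ?_) hs
  rw [zero_add, euclideanLoss_eq_ofReal hA.le α hx]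

lemma IsAlohaIntersection.laplace_vertical [Countable ιV] [IsProbabilityMeasure μ] {k : ℕ} {θ : ℝ}
    (h : IsAlohaIntersection μ lamH lamV p νH (erlangLaw k θ) ν0 XH TH SH XV TV SV S0)
    (hlamV : 0 ≤ lamV) (hp0 : 0 ≤ p) (hp1 : p ≤ 1) (hk : 1 ≤ k) (hθ : 0 < θ)
    {A α : ℝ} (hA : 0 < A) (hα : 1 < α) (d : ℝ) {s : ℝ} (hs : 0 < s) :
    ∫⁻ ω, negExp (ENNReal.ofReal s *
        alohaShotNoise XV TV SV (fun y => manhattanLoss A α (0, y) (d, 0)) ω) ∂μ =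
      ENNReal.ofReal (crossRoadLaplace p lamV k θ A α |d| s) := by
  rw [crossRoadLaplace_eq_exp_halfLineExponent]
  refine h.pointsV.laplace_alohaShotNoise hlamV hp0 hp1 hk hθ h.measurable_accessV
    h.measurable_fadingV h.accessV h.fadingV (indep_marks h.sigma_le h.indep (pt := .pointsV)
      (acc := .accessV) (fad := .fadingV) (fun _ _ => by simp) (fun _ _ => by simp) (by simp)
      (by simp) (by simp) le_rfl (fun _ => le_rfl) (fun _ => le_rfl))
    (measurable_manhattanLoss A α d) hA hα (abs_nonneg d) (MeasurePreserving.id volume)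
    (fun y hy => ?_) hs
  have hy : y ≠ 0 := hy
  rw [manhattanLoss_eq_ofReal hA.le α (by simp; positivity)]
  simp

lemma ae_pos_of_hasLaw_erlangLaw {k : ℕ} {θ : ℝ} (hS : HasLaw S0 (erlangLaw k θ) μ) :
    ∀ᵐ ω ∂μ, 0 < S0 ω := by
  refine (hS.ae_iff (p := fun x => 0 < x) (measurableSet_setOfPred.1 measurableSet_Ioi)).2 ?_
  rw [erlangLaw_eq_withDensity]
  exact (withDensity_absolutelyContinuous _ _).ae_le (ae_restrict_mem measurableSet_Ioi)

end Intersection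

theorem mainTheorem2 {Ω ιH ιV : Type*} [MeasurableSpace Ω] [Countable ιH] [Countable ιV]
    (μ : Measure Ω) [IsProbabilityMeasure μ]
    (lamH lamV p : ℝ) (hlamH : 0 ≤ lamH) (hlamV : 0 ≤ lamV) (hp0 : 0 ≤ p) (hp1 : p ≤ 1)
    (k0 kV : ℕ) (hk0 : 1 ≤ k0) (hkV : 1 ≤ kV)
    (θ0 θV : ℝ) (hθ0 : 0 < θ0) (hθV : 0 < θV)
    (AE αE AM αM : ℝ) (hAE : 0 < AE) (hαE : 1 < αE) (hAM : 0 < AM) (hαM : 1 < αM)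
    (P N β : ℝ) (hP : 0 < P) (hN : 0 ≤ N) (hβ : 0 < β)
    (xrx xtx ytx : ℝ) (hne : (xtx, ytx) ≠ (xrx, 0))
    (XH : ιH → Ω → ℝ) (TH : ιH → Ω → Bool) (SH : ιH → Ω → ℝ)
    (XV : ιV → Ω → ℝ) (TV : ιV → Ω → Bool) (SV : ιV → Ω → ℝ) (S0 : Ω → ℝ)
    (hmodel : IsAlohaIntersection μ lamH lamV p (erlangLaw 1 1) (erlangLaw kV θV)
      (erlangLaw k0 θ0) XH TH SH XV TV SV S0)
    (ζ κ d : ℝ) (hζ : ζ = β * (|xrx - xtx| + |0 - ytx|) ^ αM / (AM * θ0))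
    (hκ : κ = kappaH p lamH AE αE) (hd : d = |xrx|) :
    μ.real {ω | ENNReal.ofReal β ≤
        sinr P N (manhattanLoss AM αM) (euclideanLoss AE αE) (manhattanLoss AM αM)
          XH TH SH XV TV SV S0 (xtx, ytx) (xrx, 0) ω} =
      Real.exp (-(ζ * N / P)) *
        ∑ i ∈ Finset.range k0, ∑ j ∈ Finset.range (i + 1),
          (i.choose j : ℝ) * (ζ ^ i / (i.factorial : ℝ)) * coeffC κ αE (N / P) ζ j *
            coeffD p lamV kV θV AM αM d ζ i j ∧
    (∀ᵐ ω ∂μ, receivedInterference 1 (manhattanLoss AM αM) (fun n ω => (0, XV n ω)) TV SV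
      (xrx, 0) ω ≠ ⊤) ∧
    (∀ s : ℝ, 0 < s →
      ∫ ω, Real.exp (-s * (receivedInterference 1 (manhattanLoss AM αM) (fun n ω => (0, XV n ω))
        TV SV (xrx, 0) ω).toReal) ∂μ = crossRoadLaplace p lamV kV θV AM αM d s) ∧
    ContDiffOn ℝ (⊤ : ℕ∞) (fun s => crossRoadLaplace p lamV kV θV AM αM d s) (Set.Ioi 0) ∧
    (αE = 2 → ∀ j : ℕ, coeffC κ αE (N / P) ζ j =
      ∑ n ∈ Finset.range (j + 1), (j.choose n : ℝ) * (N / P) ^ (j - n) * (-1) ^ n *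
        Real.exp (-κ * √ζ) * (ζ ^ n)⁻¹ *
        ∑ l ∈ Finset.range (n + 1), ∑ m ∈ Finset.range (l + 1),
          (-1) ^ m * (-κ * √ζ) ^ l *
            pochhammerSymbol ((2 - (m : ℝ) + l - 2 * n) / 2) n /
              ((m.factorial : ℝ) * ((l - m).factorial : ℝ))) := by
  have hd0 : 0 ≤ d := hd ▸ abs_nonneg xrx
  have hr : 0 < |xrx - xtx| + |0 - ytx| := by
    rcases eq_or_ne xrx xtx with h | h
    · have : ytx ≠ 0 := fun h' => hne (by rw [h, h'])
      have : 0 < |0 - ytx| := by simpa using this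
      positivity
    · have : 0 < |xrx - xtx| := abs_pos.2 (sub_ne_zero.2 h)
      positivity
  have hζ0 : 0 < ζ := by
    have := Real.rpow_pos_of_pos hr αM
    rw [hζ]; positivity
  let gH : ℝ → ℝ≥0∞ := fun x => euclideanLoss AE αE (x, 0) (xrx, 0)
  let gV : ℝ → ℝ≥0∞ := fun y => manhattanLoss AM αM (0, y) (xrx, 0)
  have hgH : Measurable gH := measurable_euclideanLoss AE αE xrx
  have hgV : Measurable gV := measurable_manhattanLoss AM αM xrx
  let IH : Ω → ℝ≥0∞ := alohaShotNoise XH TH SH gH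
  let IV : Ω → ℝ≥0∞ := alohaShotNoise XV TV SV gV
  have hIH : Measurable IH := measurable_alohaShotNoise hmodel.pointsH.measurable_point
    hmodel.measurable_accessH hmodel.measurable_fadingH hgH
  have hIV : Measurable IV := measurable_alohaShotNoise hmodel.pointsV.measurable_point
    hmodel.measurable_accessV hmodel.measurable_fadingV hgV
  have hLH : ∀ s, 0 < s → ∫⁻ ω, negExp (ENNReal.ofReal s * IH ω) ∂μ =
      ENNReal.ofReal (Real.exp (-κ * s ^ (1 / αE))) := fun s hs => by
    rw [hκ]
    exact hmodel.laplace_horizontal hlamH hp0 hp1 hAE hαE xrx hs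
  have hLV : ∀ s, 0 < s → ∫⁻ ω, negExp (ENNReal.ofReal s * IV ω) ∂μ =
      ENNReal.ofReal (crossRoadLaplace p lamV kV θV AM αM d s) := fun s hs => by
    rw [hd]
    exact hmodel.laplace_vertical hlamV hp0 hp1 hkV hθV hAM hαM xrx hs
  have hfinH : ∀ᵐ ω ∂μ, IH ω ≠ ⊤ := by
    refine ae_ne_top_of_laplace hIH hLH ?_
    have hα0 : 0 < 1 / αE := by positivity
    have hcont : Continuous fun s : ℝ => Real.exp (-κ * s ^ (1 / αE)) :=
      Real.continuous_exp.comp ((Real.continuous_rpow_const hα0.le).const_mul _)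
    have := hcont.tendsto 0
    rw [Real.zero_rpow hα0.ne', mul_zero, Real.exp_zero] at this
    exact this.mono_left nhdsWithin_le_nhds
  have hfinV : ∀ᵐ ω ∂μ, IV ω ≠ ⊤ := by
    refine ae_ne_top_of_laplace hIV hLV ?_
    refine (tendsto_exp_neg_halfLineExponent (k := kV) hαM hd0 (mul_pos hAM hθV)
      (2 * p * lamV)).congr fun s => ?_
    rw [crossRoadLaplace_eq_exp_halfLineExponent, mul_right_comm AM s θV]
  have hEH : ∀ s, 0 < s → ∫ ω, Real.exp (-s * (IH ω).toReal) ∂μ =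
      Real.exp (-κ * s ^ (1 / αE)) := fun s hs =>
    integral_exp_neg_mul_toReal hIH hfinH hs (Real.exp_pos _).le (hLH s hs)
  have hEV : ∀ s, 0 < s → ∫ ω, Real.exp (-s * (IV ω).toReal) ∂μ =
      crossRoadLaplace p lamV kV θV AM αM d s := fun s hs =>
    integral_exp_neg_mul_toReal hIV hfinV hs (Real.exp_pos _).le (hLV s hs)
  have hrec : ∀ ω, receivedInterference 1 (manhattanLoss AM αM) (fun n ω => (0, XV n ω)) TV SV
      (xrx, 0) ω = IV ω := fun ω => by
    rw [receivedInterference_eq_mul_alohaShotNoise zero_le_one _ (fun y => (0, y)),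
      ENNReal.ofReal_one, one_mul]
  simp only [hrec]
  have hH0 : ∀ ω, 0 ≤ (IH ω).toReal := fun ω => ENNReal.toReal_nonneg
  have hV0 : ∀ ω, 0 ≤ (IV ω).toReal := fun ω => ENNReal.toReal_nonneg
  have hη : 0 ≤ N / P := by positivity
  refine ⟨?_, hfinV, hEV, contDiffOn_laplace hIV.ennreal_toReal hV0 hEV, ?_⟩
  · -- the events agree unless an interference is infinite or the useful fading nonpositive
    have hevent : μ.real {ω | ENNReal.ofReal β ≤
        sinr P N (manhattanLoss AM αM) (euclideanLoss AE αE) (manhattanLoss AM αM)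
          XH TH SH XV TV SV S0 (xtx, ytx) (xrx, 0) ω} =
        μ.real {ω | θ0 * (ζ * ((IH ω).toReal + (IV ω).toReal + N / P)) ≤ S0 ω} := by
      refine measureReal_congr ?_
      filter_upwards [hfinH, hfinV, ae_pos_of_hasLaw_erlangLaw hmodel.usefulFading]
        with ω h1 h2 h3
      refine propext ?_
      rw [hζ]
      exact ofReal_le_sinr_iff hP hN hβ hθ0 hAM hr h3 h1 h2
    have hindep : IndepFun (fun ω => ζ * ((IH ω).toReal + (IV ω).toReal + N / P)) S0 μ :=
      (hmodel.indepFun_interference_usefulFading hgH hgV).comp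
        (φ := fun q : ℝ≥0∞ × ℝ≥0∞ => ζ * (q.1.toReal + q.2.toReal + N / P)) (by fun_prop)
        measurable_id
    rw [hevent, measureReal_mul_le_erlang hk0 hθ0 (by fun_prop)
      (fun ω => mul_nonneg hζ0.le (add_nonneg (add_nonneg (hH0 ω) (hV0 ω)) hη))
      hmodel.measurable_usefulFading hmodel.usefulFading hindep,
      integral_erlang_tail hIH.ennreal_toReal hIV.ennreal_toReal hH0 hV0
        ((hmodel.indepFun_interference hgH hgV).comp ENNReal.measurable_toReal
          ENNReal.measurable_toReal) hζ0, ← mul_div_assoc]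
    congr 1
    refine Finset.sum_congr rfl fun i _ => Finset.sum_congr rfl fun j _ => ?_
    rw [coeffC_eq_sum_iteratedDeriv κ αE (N / P) hζ0, coeffD,
      iteratedDeriv_laplace hIV.ennreal_toReal hV0 hEV hζ0]
    simp_rw [iteratedDeriv_laplace hIH.ennreal_toReal hH0 hEH hζ0]
  · rintro rfl j
    simp only [coeffC, Real.sqrt_eq_rpow]
    refine Finset.sum_congr rfl fun n _ => ?_
    congr 1
    refine Finset.sum_congr rfl fun l _ => Finset.sum_congr rfl fun m _ => ?_
    rw [show ((l : ℝ) - m) / 2 + 1 - n = (2 - (m : ℝ) + l - 2 * n) / 2 by ring]
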